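/- Let $s\ge 0$ and $n\ge 1$ be integers, and let $\tilde a_i\in\mathbb C$ and $a_i(\nu)\in\mathbb C$ ($0\le i\le n$, $\nu=0,1,2,\dots$) satisfy $a_n(\nu)=1$ for all $\nu$ and $a_i(\nu)-\tilde a_i=O(1/(\nu+1))$ for $0\le i\le n$. Let $T(z)=\sum_{i=0}^n\tilde a_i z^i$. Let $\rho_1>\rho_2>\dots>\rho_{s+1}=0$ be real numbers such that the absolute value of every root of $T$ is one of the $\rho_i$. For $1\le i\le s$ let $e_i$ and $k_i$ be the sum and the maximum of the multiplicities of the roots of $T$ of absolute value $\rho_i$, suppose that $e_i>0$ for $1\le i\le s$, and let $k=\max(k_1,\dots,k_s)$. For an integer $m\ge 1$ let $V_m$ be the complex vector space of the sequences $y=(y(\nu))_{\nu\ge m}$ of complex numbers with $\sum_{i=0}^n a_i(\nu)\,y(\nu+i)=0$ for all $\nu\ge m$; for $1\le j\le s+1$ let $V_{m,j}^\wedge=\{y\in V_m:\ \limsup_{\nu\to\infty}|y(\nu)|^{1/\nu}\le\rho_j\}$, which is a linear subspace of $V_m$; and let $\omega_{n,y}(\nu)=\max(|y(\nu)|,\dots,|y(\nu+n-1)|)$.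 Then for every integer $m\ge1$, every $\theta\in\{1,\dots,s\}$ and every linear subspace $V$ of $V_m$ with $V\cap V_{m,\theta+1}^\wedge=\{0\}$ there is a constant $A^*=A^*(V)>0$ such that, for all $y\in V$ and all integers $\nu\ge m$, $$\omega_{n,y}(\nu)\ \ge\ \exp\bigl(-A^*(\ln\nu+\nu^{1-1/k})\bigr)\,\rho_\theta^{\,\nu}\,\omega_{n,y}(m).$$ -/

import Mathlib

open Filter Topology
open scoped ENNReal

namespace PoincareDifference

/-- The index `ν + k`, for `ν ∈ {m, m + 1, …}`. -/
def shift {m : ℕ} (ν : Set.Ici m) (k : ℕ) : Set.Ici m :=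
  ⟨ν.1 + k, le_trans ν.2 (Nat.le_add_right _ _)⟩

/-- The space `V_m` of the sequences `y(m), y(m+1), …` of complex numbers that satisfy
`∑_{k=0}^n a_k(ν) y(ν+k) = 0` for every `ν ≥ m`. -/
def solutionSpace {n : ℕ} (a : Fin (n + 1) → ℕ → ℂ) (m : ℕ) :
    Submodule ℂ (Set.Ici m → ℂ) where
  carrier := {y | ∀ ν : Set.Ici m, ∑ k : Fin (n + 1), a k ν.1 * y (shift ν k) = 0}
  zero_mem' := by intro ν; simp
  add_mem' := by
    intro x y hx hy ν
    have h1 := hx ν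
    have h2 := hy ν
    simp only [Pi.add_apply, mul_add, Finset.sum_add_distrib, h1, h2, add_zero]
  smul_mem' := by
    intro c y hy ν
    have h1 := hy ν
    simp only [Pi.smul_apply, smul_eq_mul, mul_left_comm _ c, ← Finset.mul_sum, h1, mul_zero]

/-- `limsup_{ν → ∞} |y(ν)|^{1/ν}`, an element of `[0, ∞]`. -/
noncomputable def growthRate {m : ℕ} (y : Set.Ici m → ℂ) : ℝ≥0∞ :=
  limsup (fun ν : Set.Ici m => ‖y ν‖ₑ ^ (1 / (ν.1 : ℝ))) atTop

theorem tendsto_coe_Ici (m : ℕ) : Tendsto (fun ν : Set.Ici m => ν.1) atTop atTop :=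
  tendsto_atTop_atTop.2 fun b => ⟨⟨max m b, Set.mem_Ici.2 (le_max_left m b)⟩, fun ν hν =>
    le_trans (le_max_right m b) hν⟩

/-- A sequence dominated by a constant times the maximum of two sequences does not grow faster
than the two. -/
theorem growthRate_le_of_le {m : ℕ} {x y z : Set.Ici m → ℂ} {C L : ℝ≥0∞} (hC0 : C ≠ 0)
    (hC : C ≠ ∞) (h : ∀ ν, ‖z ν‖ₑ ≤ C * max ‖x ν‖ₑ ‖y ν‖ₑ)
    (hx : growthRate x ≤ L) (hy : growthRate y ≤ L) : growthRate z ≤ L := by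
  refine le_of_forall_gt_imp_ge_of_dense fun r hr => ?_
  have hx' := eventually_lt_of_limsup_lt (lt_of_le_of_lt hx hr)
  have hy' := eventually_lt_of_limsup_lt (lt_of_le_of_lt hy hr)
  have hlim : Tendsto (fun ν : Set.Ici m => C ^ (1 / (ν.1 : ℝ)) * r) atTop (𝓝 (1 * r)) := by
    refine ENNReal.Tendsto.mul_const ?_ (Or.inl one_ne_zero)
    have h0 : Tendsto (fun ν : Set.Ici m => 1 / (ν.1 : ℝ)) atTop (𝓝 0) :=
      tendsto_one_div_atTop_nhds_zero_nat.comp (tendsto_coe_Ici m)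
    lift C to NNReal using hC
    have hC1 : C ≠ 0 := by exact_mod_cast hC0
    have h1 : Tendsto (fun ν : Set.Ici m => C ^ (1 / (ν.1 : ℝ))) atTop (𝓝 (C ^ (0 : ℝ))) :=
      tendsto_const_nhds.nnrpow h0 (Or.inl hC1)
    rw [NNReal.rpow_zero] at h1
    have h2 := ENNReal.tendsto_coe.2 h1
    simpa [ENNReal.coe_rpow_of_ne_zero hC1] using h2
  rw [one_mul] at hlim
  rw [← hlim.limsup_eq]
  refine limsup_le_limsup ?_
  filter_upwards [hx', hy'] with ν h1 h2
  have hp : (0 : ℝ) ≤ 1 / (ν.1 : ℝ) := by positivity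
  calc ‖z ν‖ₑ ^ (1 / (ν.1 : ℝ))
      ≤ (C * max ‖x ν‖ₑ ‖y ν‖ₑ) ^ (1 / (ν.1 : ℝ)) := ENNReal.rpow_le_rpow (h ν) hp
    _ = C ^ (1 / (ν.1 : ℝ)) * (max ‖x ν‖ₑ ‖y ν‖ₑ) ^ (1 / (ν.1 : ℝ)) :=
        ENNReal.mul_rpow_of_nonneg _ _ hp
    _ ≤ C ^ (1 / (ν.1 : ℝ)) * r := by
        gcongr
        rcases le_total ‖x ν‖ₑ ‖y ν‖ₑ with h3 | h3
        · rw [max_eq_right h3]; exact h2.le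
        · rw [max_eq_left h3]; exact h1.le

theorem growthRate_zero {m : ℕ} : growthRate (0 : Set.Ici m → ℂ) = 0 := by
  have h : (fun ν : Set.Ici m => ‖(0 : Set.Ici m → ℂ) ν‖ₑ ^ (1 / (ν.1 : ℝ)))
      =ᶠ[atTop] fun _ => 0 := by
    filter_upwards [(tendsto_coe_Ici m).eventually (eventually_gt_atTop 0)] with ν hν
    have : (0 : ℝ) < 1 / (ν.1 : ℝ) := by positivity
    simp only [Pi.zero_apply, enorm_zero, ENNReal.zero_rpow_of_pos this]
  rw [growthRate, limsup_congr h, limsup_const]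

/-- The subspace `V_m^∧(ρ) = {y ∈ V_m : limsup |y(ν)|^{1/ν} ≤ ρ}` of `V_m`. -/
noncomputable def slowSubspace {n : ℕ} (a : Fin (n + 1) → ℕ → ℂ) (m : ℕ) (ρ : ℝ) :
    Submodule ℂ (Set.Ici m → ℂ) where
  carrier := {y | y ∈ solutionSpace a m ∧ growthRate y ≤ ENNReal.ofReal ρ}
  zero_mem' := ⟨zero_mem _, by rw [growthRate_zero]; exact zero_le⟩
  add_mem' := by
    rintro x y ⟨hx, hx'⟩ ⟨hy, hy'⟩
    refine ⟨add_mem hx hy, growthRate_le_of_le (C := 2) (by simp) (by simp) (fun ν => ?_) hx' hy'⟩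
    calc ‖(x + y) ν‖ₑ ≤ ‖x ν‖ₑ + ‖y ν‖ₑ := enorm_add_le _ _
      _ ≤ max ‖x ν‖ₑ ‖y ν‖ₑ + max ‖x ν‖ₑ ‖y ν‖ₑ :=
          add_le_add (le_max_left _ _) (le_max_right _ _)
      _ = 2 * max ‖x ν‖ₑ ‖y ν‖ₑ := (two_mul _).symm
  smul_mem' := by
    rintro c y ⟨hy, hy'⟩
    refine ⟨Submodule.smul_mem _ _ hy, growthRate_le_of_le (x := y) (C := ‖c‖ₑ + 1) (by simp)
      (by simp) (fun ν => ?_) hy' hy'⟩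
    rw [max_self, Pi.smul_apply, smul_eq_mul, enorm_mul]
    gcongr
    exact le_self_add

/-- `ω_{n,y}(ν) = max (|y(ν)|, …, |y(ν+n-1)|)`: the norm of `Fin n → ℂ` is the maximum of the
absolute values of the coordinates. -/
noncomputable def omega (n : ℕ) {m : ℕ} (y : Set.Ici m → ℂ) (ν : Set.Ici m) : ℝ :=
  ‖fun j : Fin n => y (shift ν j)‖

/-- The characteristic polynomial `T(z) = ∑_{k=0}^n ã_k z^k`. -/
noncomputable def charPoly {n : ℕ} (a' : Fin (n + 1) → ℂ) : Polynomial ℂ :=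
  ∑ k : Fin (n + 1), Polynomial.C (a' k) * Polynomial.X ^ (k : ℕ)

/-- The sum of the multiplicities of the roots of `T` of absolute value `r`. -/
noncomputable def multSum (T : Polynomial ℂ) (r : ℝ) : ℕ :=
  ∑ z ∈ T.roots.toFinset with ‖z‖ = r, T.rootMultiplicity z

/-- The maximum of the multiplicities of the roots of `T` of absolute value `r`
(`0` if there are none). -/
noncomputable def multMax (T : Polynomial ℂ) (r : ℝ) : ℕ :=
  {z ∈ T.roots.toFinset | ‖z‖ = r}.sup fun z => T.rootMultiplicity z

open Polynomial

/-!
Let `μ(z)` be the multiplicity of the root `z` of `T`. For `j < μ(z)` the difference operators of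
the polynomials `(X - z)ʲ ∏_{w ≠ z} (X - w)^μ(w)` are coordinates on the windows
`(y(ν), …, y(ν+n-1))` in which the constant coefficient equation is in Jordan form. Give the `j`-th
coordinate at `ν` the weight `(ν+1)^{j/k}`: then the off-diagonal part of the Jordan blocks, the
perturbation of the coefficients and the change of the weights are all of relative size
`O((ν+1)^{-1/k})` per step, and these sum up to `O(ln ν + ν^{1-1/k})`.

Split the coordinates according to `|z| ≥ ρ_θ` (fast) and `|z| ≤ ρ_{θ+1}` (slow). Once the fast part
of a solution exceeds the slow part, it does so forever and grows like `ρ_θ^ν` up to these losses.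
If this never happens, the solution grows at rate at most `ρ_{θ+1}`, so it lies in
`V_{m,θ+1}^∧`. The slow part only needs losses tending to `0`, so its weights may have `n` in place
of `k`. By compactness of the solutions in `V` with `ω(m) = 1`, the fast part dominates from
a common index on.
-/

section DifferenceOperator

variable {R : Type*} [CommRing R]

/-- The difference operator `u ↦ (ν ↦ ∑ i, gᵢ u(ν + i))` attached to the polynomial `g`: the
variable acts as the shift of sequences. -/
noncomputable def diffOp : R[X] →ₐ[R] Module.End R (ℕ → R) :=
  aeval (LinearMap.funLeft R R Nat.succ)

theorem diffOp_X_pow_apply (i : ℕ) (u : ℕ → R) (ν : ℕ) : diffOp (X ^ i) u ν = u (ν + i) := by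
  induction i generalizing ν with
  | zero => simp
  | succ i ih =>
    rw [pow_succ', map_mul, diffOp, aeval_X, Module.End.mul_apply, LinearMap.funLeft_apply]
    exact (ih (ν + 1)).trans (congrArg u (by omega))

theorem diffOp_apply {g : R[X]} {N : ℕ} (hg : g.natDegree < N) (u : ℕ → R) (ν : ℕ) :
    diffOp g u ν = ∑ i ∈ Finset.range N, g.coeff i * u (ν + i) := by
  conv_lhs => rw [as_sum_range' g N hg]
  simp only [← smul_X_eq_monomial, map_sum, map_smul, LinearMap.sum_apply, LinearMap.smul_apply,
    Finset.sum_apply, Pi.smul_apply, diffOp_X_pow_apply, smul_eq_mul]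

theorem diffOp_apply_succ (z : R) (g : R[X]) (u : ℕ → R) (ν : ℕ) :
    diffOp g u (ν + 1) = z * diffOp g u ν + diffOp ((X - C z) * g) u ν := by
  have h : diffOp (X * g) u ν = diffOp g u (ν + 1) := by
    rw [map_mul, diffOp, aeval_X, Module.End.mul_apply, LinearMap.funLeft_apply]
  rw [← h, sub_mul, map_sub, C_mul', map_smul, LinearMap.sub_apply, Pi.sub_apply,
    LinearMap.smul_apply, Pi.smul_apply, smul_eq_mul, add_sub_cancel]

end DifferenceOperator

section JordanPoly

variable {𝕜 : Type*} [Field 𝕜] [DecidableEq 𝕜] {T : 𝕜[X]} {z : 𝕜}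

/-- The polynomial `(X - z)ʲ T / (X - z)^μ`, where `μ` is the multiplicity of the root `z` of `T`.
For `j < μ` the difference operators of these polynomials are the coordinates that put the shift
on the solutions of `diffOp T u = 0` into Jordan form. -/
noncomputable def jordanPoly (T : 𝕜[X]) (z : 𝕜) (j : ℕ) : 𝕜[X] :=
  (X - C z) ^ j * ∏ w ∈ T.roots.toFinset.erase z, (X - C w) ^ T.rootMultiplicity w

theorem jordanPoly_succ (T : 𝕜[X]) (z : 𝕜) (j : ℕ) :
    jordanPoly T z (j + 1) = (X - C z) * jordanPoly T z j := by
  rw [jordanPoly, jordanPoly, pow_succ', mul_assoc]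

theorem monic_jordanPoly (T : 𝕜[X]) (z : 𝕜) (j : ℕ) : (jordanPoly T z j).Monic :=
  ((monic_X_sub_C z).pow j).mul (monic_prod_of_monic _ _ fun w _ => (monic_X_sub_C w).pow _)

theorem prod_X_sub_C_pow_rootMultiplicity (hT : T.Monic) (hs : T.Splits) :
    ∏ w ∈ T.roots.toFinset, (X - C w) ^ T.rootMultiplicity w = T := by
  rw [← prod_multiset_root_eq_finset_root, ← hs.eq_prod_roots_of_monic hT]

theorem jordanPoly_rootMultiplicity (hT : T.Monic) (hs : T.Splits) (hz : z ∈ T.roots.toFinset) :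
    jordanPoly T z (T.rootMultiplicity z) = T := by
  rw [jordanPoly, Finset.mul_prod_erase _ (fun w => (X - C w) ^ T.rootMultiplicity w) hz,
    prod_X_sub_C_pow_rootMultiplicity hT hs]

theorem natDegree_jordanPoly_lt (hT : T.Monic) (hs : T.Splits) (hz : z ∈ T.roots.toFinset)
    {j : ℕ} (hj : j < T.rootMultiplicity z) : (jordanPoly T z j).natDegree < T.natDegree := by
  have hfactor : T = (X - C z) ^ (T.rootMultiplicity z - j) * jordanPoly T z j := by
    conv_lhs => rw [← jordanPoly_rootMultiplicity hT hs hz]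
    rw [jordanPoly, jordanPoly, ← mul_assoc, ← pow_add, Nat.sub_add_cancel hj.le]
  have hdegree := congrArg natDegree hfactor
  rw [((monic_X_sub_C z).pow _).natDegree_mul (monic_jordanPoly T z j), natDegree_pow,
    natDegree_X_sub_C] at hdegree
  omega

theorem exists_eq_sum_smul_jordanPoly (hT : T.Monic) (hs : T.Splits) {g : 𝕜[X]}
    (hg : g.degree < T.degree) :
    ∃ c : 𝕜 → ℕ → 𝕜, g = ∑ z ∈ T.roots.toFinset, ∑ j ∈ Finset.range (T.rootMultiplicity z),
      c z j • jordanPoly T z j := by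
  obtain ⟨q, r, hr, hgr⟩ := eq_quo_mul_prod_pow_add_sum_rem_mul_prod_pow g
    (fun z (_ : z ∈ T.roots.toFinset) => monic_X_sub_C z)
    (fun _ _ _ _ h => pairwise_coprime_X_sub_C Function.injective_id h) T.rootMultiplicity
  rw [prod_X_sub_C_pow_rootMultiplicity hT hs] at hgr
  let c : 𝕜 → ℕ → 𝕜 := fun z j =>
    if h : j < T.rootMultiplicity z then (r z ⟨j, h⟩).coeff 0 else 0
  have hsum : ∑ z ∈ T.roots.toFinset, ∑ j, r z j * (X - C z) ^ j.1 *
      ∏ w ∈ T.roots.toFinset.erase z, (X - C w) ^ T.rootMultiplicity w =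
      ∑ z ∈ T.roots.toFinset, ∑ j ∈ Finset.range (T.rootMultiplicity z),
        c z j • jordanPoly T z j := by
    refine Finset.sum_congr rfl fun z hz => ?_
    rw [Finset.sum_range]
    refine Finset.sum_congr rfl fun j _ => ?_
    have hconst : (r z j).degree ≤ 0 :=
      Nat.WithBot.lt_one_iff_le_zero.1 ((hr z hz j).trans_eq (degree_X_sub_C z))
    rw [eq_C_of_degree_le_zero hconst, ← smul_eq_C_mul, smul_mul_assoc]
    simp only [c, j.2, dif_pos, Fin.eta, jordanPoly]
  rw [hsum] at hgr
  have hq : g - ∑ z ∈ T.roots.toFinset, ∑ j ∈ Finset.range (T.rootMultiplicity z),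
      c z j • jordanPoly T z j = T * q := by
    rw [sub_eq_iff_eq_add, mul_comm, ← hgr]
  refine ⟨c, sub_eq_zero.1 (by_contra fun hne => ?_)⟩
  refine hT.not_dvd_of_degree_lt hne ?_ (Dvd.intro q hq.symm)
  refine (degree_sub_le _ _).trans_lt (max_lt hg ?_)
  rw [degree_eq_natDegree hT.ne_zero, ← mem_degreeLT]
  refine Submodule.sum_mem _ fun z hz => Submodule.sum_mem _ fun j hj =>
    Submodule.smul_mem _ _ (mem_degreeLT.2 ?_)
  exact natDegree_lt_iff_degree_lt (monic_jordanPoly T z j).ne_zero |>.1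
    (natDegree_jordanPoly_lt hT hs hz (Finset.mem_range.1 hj))

end JordanPoly

section Window

variable {𝕜 : Type*} [NormedField 𝕜]

/-- The maximum of `‖u ν‖, …, ‖u (ν + n - 1)‖`. -/
noncomputable def window (n : ℕ) (u : ℕ → 𝕜) (ν : ℕ) : ℝ :=
  ‖fun j : Fin n => u (ν + j)‖

theorem window_nonneg (n : ℕ) (u : ℕ → 𝕜) (ν : ℕ) : 0 ≤ window n u ν := norm_nonneg _

theorem norm_le_window {n i : ℕ} (hi : i < n) (u : ℕ → 𝕜) (ν : ℕ) :
    ‖u (ν + i)‖ ≤ window n u ν :=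
  norm_le_pi_norm (fun j : Fin n => u (ν + j)) ⟨i, hi⟩

theorem norm_diffOp_le_window {g : 𝕜[X]} {n : ℕ} (hg : g.natDegree < n) (u : ℕ → 𝕜) (ν : ℕ) :
    ‖diffOp g u ν‖ ≤ (∑ i ∈ Finset.range n, ‖g.coeff i‖) * window n u ν := by
  rw [diffOp_apply hg, Finset.sum_mul]
  refine norm_sum_le_of_le _ fun i hi => ?_
  rw [norm_mul]
  gcongr
  exact norm_le_window (Finset.mem_range.1 hi) u ν

theorem continuous_diffOp_apply (g : 𝕜[X]) (ν : ℕ) : Continuous fun u : ℕ → 𝕜 => diffOp g u ν := by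
  simp only [diffOp_apply (Nat.lt_succ_self g.natDegree)]
  fun_prop

end Window

section JordanNorm

theorem abs_sum_pow_mul_norm_sub_le {𝕜 : Type*} [NormedField 𝕜] {t : ℝ} (ht : 0 < t) {μ : ℕ}
    (hμ : 0 < μ) {z : 𝕜} {x x' : ℕ → 𝕜} (h : ∀ j < μ, x' j = z * x j + x (j + 1)) :
    |∑ j ∈ Finset.range μ, t ^ j * ‖x' j‖ - ‖z‖ * ∑ j ∈ Finset.range μ, t ^ j * ‖x j‖|
      ≤ t⁻¹ * ∑ j ∈ Finset.range μ, t ^ j * ‖x j‖ + t ^ (μ - 1) * ‖x μ‖ := by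
  obtain ⟨l, rfl⟩ : ∃ l, μ = l + 1 := Nat.exists_eq_succ_of_ne_zero hμ.ne'
  have hterm : ∀ j ∈ Finset.range (l + 1),
      |t ^ j * ‖x' j‖ - ‖z‖ * (t ^ j * ‖x j‖)| ≤ t ^ j * ‖x (j + 1)‖ := fun j hj => by
    rw [mul_left_comm, ← norm_mul, ← mul_sub, abs_mul, abs_of_pos (pow_pos ht j)]
    gcongr
    refine (abs_norm_sub_norm_le _ _).trans_eq ?_
    rw [h j (Finset.mem_range.1 hj), add_sub_cancel_left]
  have hshift : ∑ j ∈ Finset.range l, t ^ j * ‖x (j + 1)‖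
      ≤ t⁻¹ * ∑ j ∈ Finset.range (l + 1), t ^ j * ‖x j‖ := by
    rw [Finset.sum_range_succ', mul_add, Finset.mul_sum]
    refine le_add_of_le_of_nonneg (Finset.sum_le_sum fun j _ => ?_) (by positivity)
    rw [pow_succ', mul_assoc, inv_mul_cancel_left₀ ht.ne']
  calc |∑ j ∈ Finset.range (l + 1), t ^ j * ‖x' j‖
        - ‖z‖ * ∑ j ∈ Finset.range (l + 1), t ^ j * ‖x j‖|
      ≤ ∑ j ∈ Finset.range (l + 1), t ^ j * ‖x (j + 1)‖ := by
        rw [Finset.mul_sum, ← Finset.sum_sub_distrib]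
        exact (Finset.abs_sum_le_sum_abs _ _).trans (Finset.sum_le_sum hterm)
    _ ≤ _ := by
        rw [Finset.sum_range_succ, Nat.add_sub_cancel]
        gcongr

variable {𝕜 : Type*} [NormedField 𝕜] [DecidableEq 𝕜] {T : 𝕜[X]} {S : Finset 𝕜} {K : ℕ} {t : ℝ}

/-- The size at `ν` of the Jordan coordinates of `u` belonging to the root `z` of `T`, the `j`-th
of which has weight `tʲ`. A large `t` makes the off-diagonal part of the Jordan block small. -/
noncomputable def chainNorm (T : 𝕜[X]) (z : 𝕜) (t : ℝ) (u : ℕ → 𝕜) (ν : ℕ) : ℝ :=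
  ∑ j ∈ Finset.range (T.rootMultiplicity z), t ^ j * ‖diffOp (jordanPoly T z j) u ν‖

/-- The size at `ν` of the Jordan coordinates of `u` belonging to the roots of `T` in `S`. -/
noncomputable def jordanNorm (T : 𝕜[X]) (S : Finset 𝕜) (t : ℝ) (u : ℕ → 𝕜) (ν : ℕ) : ℝ :=
  ∑ z ∈ S, chainNorm T z t u ν

theorem chainNorm_nonneg (T : 𝕜[X]) (z : 𝕜) (ht : 0 ≤ t) (u : ℕ → 𝕜) (ν : ℕ) :
    0 ≤ chainNorm T z t u ν :=
  Finset.sum_nonneg fun _ _ => by positivity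

theorem jordanNorm_nonneg (T : 𝕜[X]) (S : Finset 𝕜) (ht : 0 ≤ t) (u : ℕ → 𝕜) (ν : ℕ) :
    0 ≤ jordanNorm T S t u ν :=
  Finset.sum_nonneg fun z _ => chainNorm_nonneg T z ht u ν

theorem jordanNorm_mono (T : 𝕜[X]) (S : Finset 𝕜) {t' : ℝ} (ht : 0 ≤ t) (h : t ≤ t')
    (u : ℕ → 𝕜) (ν : ℕ) : jordanNorm T S t u ν ≤ jordanNorm T S t' u ν :=
  Finset.sum_le_sum fun _ _ => Finset.sum_le_sum fun _ _ => by gcongr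

theorem jordanNorm_le_div_pow_mul {t' : ℝ} (hK : ∀ z ∈ S, T.rootMultiplicity z ≤ K) (ht : 0 < t)
    (h : t ≤ t') (u : ℕ → 𝕜) (ν : ℕ) :
    jordanNorm T S t' u ν ≤ (t' / t) ^ K * jordanNorm T S t u ν := by
  rw [jordanNorm, jordanNorm, Finset.mul_sum]
  refine Finset.sum_le_sum fun z hz => ?_
  rw [chainNorm, chainNorm, Finset.mul_sum]
  refine Finset.sum_le_sum fun j hj => ?_
  have hjK : j ≤ K := (Finset.mem_range.1 hj).le.trans (hK z hz)
  calc t' ^ j * ‖diffOp (jordanPoly T z j) u ν‖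
      = (t' / t) ^ j * (t ^ j * ‖diffOp (jordanPoly T z j) u ν‖) := by
        rw [← mul_assoc, ← mul_pow, div_mul_cancel₀ _ ht.ne']
    _ ≤ (t' / t) ^ K * (t ^ j * ‖diffOp (jordanPoly T z j) u ν‖) := by
        gcongr
        exact (one_le_div ht).2 h

theorem continuous_jordanNorm (T : 𝕜[X]) (S : Finset 𝕜) (t : ℝ) (ν : ℕ) :
    Continuous fun u : ℕ → 𝕜 => jordanNorm T S t u ν := by
  have hcont := fun g : 𝕜[X] => continuous_diffOp_apply g ν
  unfold jordanNorm chainNorm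
  fun_prop

theorem abs_chainNorm_succ_sub_le (hT : T.Monic) (hs : T.Splits) {z : 𝕜}
    (hz : z ∈ T.roots.toFinset) (ht : 1 ≤ t) (hK : T.rootMultiplicity z ≤ K) (u : ℕ → 𝕜) (ν : ℕ) :
    |chainNorm T z t u (ν + 1) - ‖z‖ * chainNorm T z t u ν|
      ≤ t⁻¹ * chainNorm T z t u ν + t ^ (K - 1) * ‖diffOp T u ν‖ := by
  have hpos : 0 < T.rootMultiplicity z :=
    (rootMultiplicity_pos hT.ne_zero).2 (isRoot_of_mem_roots (Multiset.mem_toFinset.1 hz))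
  refine (abs_sum_pow_mul_norm_sub_le (zero_lt_one.trans_le ht) hpos
    (x := fun j => diffOp (jordanPoly T z j) u ν) fun j _ => ?_).trans ?_
  · rw [diffOp_apply_succ z, jordanPoly_succ]
  · rw [jordanPoly_rootMultiplicity hT hs hz, chainNorm]
    gcongr

theorem mul_jordanNorm_sub_le_jordanNorm_succ (hT : T.Monic) (hs : T.Splits)
    (hS : S ⊆ T.roots.toFinset) (ht : 1 ≤ t) (hK : ∀ z ∈ S, T.rootMultiplicity z ≤ K) {r : ℝ}
    (hr : ∀ z ∈ S, r ≤ ‖z‖) (u : ℕ → 𝕜) (ν : ℕ) :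
    (r - t⁻¹) * jordanNorm T S t u ν - S.card * (t ^ (K - 1) * ‖diffOp T u ν‖)
      ≤ jordanNorm T S t u (ν + 1) := by
  rw [jordanNorm, jordanNorm, Finset.mul_sum, ← nsmul_eq_mul, ← Finset.sum_const,
    ← Finset.sum_sub_distrib]
  refine Finset.sum_le_sum fun z hz => ?_
  have hchain := (abs_le.1 (abs_chainNorm_succ_sub_le hT hs (hS hz) ht (hK z hz) u ν)).1
  have hmodulus := mul_le_mul_of_nonneg_right (hr z hz)
    (chainNorm_nonneg T z (zero_le_one.trans ht) u ν)
  linarith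

theorem jordanNorm_succ_le (hT : T.Monic) (hs : T.Splits) (hS : S ⊆ T.roots.toFinset)
    (ht : 1 ≤ t) (hK : ∀ z ∈ S, T.rootMultiplicity z ≤ K) {r : ℝ} (hr : ∀ z ∈ S, ‖z‖ ≤ r)
    (u : ℕ → 𝕜) (ν : ℕ) :
    jordanNorm T S t u (ν + 1)
      ≤ (r + t⁻¹) * jordanNorm T S t u ν + S.card * (t ^ (K - 1) * ‖diffOp T u ν‖) := by
  rw [jordanNorm, jordanNorm, Finset.mul_sum, ← nsmul_eq_mul, ← Finset.sum_const,
    ← Finset.sum_add_distrib]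
  refine Finset.sum_le_sum fun z hz => ?_
  have hchain := (abs_le.1 (abs_chainNorm_succ_sub_le hT hs (hS hz) ht (hK z hz) u ν)).2
  have hmodulus := mul_le_mul_of_nonneg_right (hr z hz)
    (chainNorm_nonneg T z (zero_le_one.trans ht) u ν)
  linarith

theorem norm_diffOp_jordanPoly_le_jordanNorm {z : 𝕜} (hz : z ∈ S) {j : ℕ}
    (hj : j < T.rootMultiplicity z) (u : ℕ → 𝕜) (ν : ℕ) :
    ‖diffOp (jordanPoly T z j) u ν‖ ≤ jordanNorm T S 1 u ν := by
  have hterm : ‖diffOp (jordanPoly T z j) u ν‖ ≤ chainNorm T z 1 u ν := by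
    simpa only [chainNorm, one_pow, one_mul] using Finset.single_le_sum
      (f := fun j => (1 : ℝ) ^ j * ‖diffOp (jordanPoly T z j) u ν‖)
      (fun _ _ => by positivity) (Finset.mem_range.2 hj)
  exact hterm.trans (Finset.single_le_sum (f := fun z => chainNorm T z 1 u ν)
    (fun w _ => chainNorm_nonneg T w zero_le_one u ν) hz)

theorem exists_norm_diffOp_le_jordanNorm (hT : T.Monic) (hs : T.Splits) {g : 𝕜[X]}
    (hg : g.degree < T.degree) :
    ∃ C : ℝ, 0 ≤ C ∧ ∀ u ν, ‖diffOp g u ν‖ ≤ C * jordanNorm T T.roots.toFinset 1 u ν := by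
  obtain ⟨c, hc⟩ := exists_eq_sum_smul_jordanPoly hT hs hg
  refine ⟨∑ z ∈ T.roots.toFinset, ∑ j ∈ Finset.range (T.rootMultiplicity z), ‖c z j‖,
    by positivity, fun u ν => ?_⟩
  conv_lhs => rw [hc]
  simp only [map_sum, map_smul, LinearMap.sum_apply, LinearMap.smul_apply, Finset.sum_apply,
    Pi.smul_apply, Finset.sum_mul]
  refine norm_sum_le_of_le _ fun z hz => norm_sum_le_of_le _ fun j hj => ?_
  rw [norm_smul]
  gcongr
  exact norm_diffOp_jordanPoly_le_jordanNorm hz (Finset.mem_range.1 hj) u ν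

theorem exists_window_le_jordanNorm (hT : T.Monic) (hs : T.Splits) :
    ∃ C : ℝ, 0 ≤ C ∧
      ∀ u ν, window T.natDegree u ν ≤ C * jordanNorm T T.roots.toFinset 1 u ν := by
  have hdegree : ∀ i : Fin T.natDegree, (X ^ (i : ℕ) : 𝕜[X]).degree < T.degree := fun i => by
    rw [degree_X_pow, degree_eq_natDegree hT.ne_zero]
    exact_mod_cast i.2
  choose C hC hbound using fun i => exists_norm_diffOp_le_jordanNorm hT hs (hdegree i)
  have hsum : 0 ≤ ∑ i, C i := Finset.sum_nonneg fun i _ => hC i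
  refine ⟨∑ i, C i, hsum, fun u ν => ?_⟩
  have hnorm := jordanNorm_nonneg T T.roots.toFinset zero_le_one u ν
  refine (pi_norm_le_iff_of_nonneg (mul_nonneg hsum hnorm)).2 fun i => ?_
  calc ‖u (ν + i)‖ = ‖diffOp (X ^ (i : ℕ)) u ν‖ := by rw [diffOp_X_pow_apply]
    _ ≤ C i * jordanNorm T T.roots.toFinset 1 u ν := hbound i u ν
    _ ≤ _ := by
      gcongr
      exact Finset.single_le_sum (fun i _ => hC i) (Finset.mem_univ i)

theorem exists_jordanNorm_le_window (hT : T.Monic) (hs : T.Splits) (hS : S ⊆ T.roots.toFinset)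
    (hK : ∀ z ∈ S, T.rootMultiplicity z ≤ K) :
    ∃ C : ℝ, 0 ≤ C ∧ ∀ t : ℝ, 1 ≤ t → ∀ u ν,
      jordanNorm T S t u ν ≤ C * (t ^ (K - 1) * window T.natDegree u ν) := by
  refine ⟨∑ z ∈ S, ∑ j ∈ Finset.range (T.rootMultiplicity z),
    ∑ i ∈ Finset.range T.natDegree, ‖(jordanPoly T z j).coeff i‖, by positivity,
    fun t ht u ν => ?_⟩
  simp only [jordanNorm, chainNorm, Finset.sum_mul]
  refine Finset.sum_le_sum fun z hz => Finset.sum_le_sum fun j hj => ?_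
  have hj' := Finset.mem_range.1 hj
  have hjK : j ≤ K - 1 := by have := hK z hz; omega
  rw [← Finset.sum_mul, mul_left_comm]
  gcongr
  exact norm_diffOp_le_window (natDegree_jordanPoly_lt hT hs (hS hz) hj') u ν

end JordanNorm

section Scale

/-- The exponent `ln ν + ν^{1 - 1/k}` of the loss in the lower bound for solutions. -/
noncomputable def lossExponent (k ν : ℕ) : ℝ := Real.log ν + (ν : ℝ) ^ (1 - 1 / (k : ℝ))

/-- The parameter `(ν + 1)^{1/k}` of the weights at `ν`. With multiplicities at most `k`, a
perturbation of size `1 / (ν + 1)` then costs as much as the off-diagonal part of a Jordan block,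
namely `(scale k ν)⁻¹`. -/
noncomputable def scale (k ν : ℕ) : ℝ := ((ν : ℝ) + 1) ^ (1 / (k : ℝ))

theorem one_le_scale (k ν : ℕ) : 1 ≤ scale k ν :=
  Real.one_le_rpow (le_add_of_nonneg_left ν.cast_nonneg) (by positivity)

theorem scale_pos (k ν : ℕ) : 0 < scale k ν := zero_lt_one.trans_le (one_le_scale k ν)

theorem scale_inv_nonneg (k ν : ℕ) : 0 ≤ (scale k ν)⁻¹ := inv_nonneg.2 (scale_pos k ν).le

theorem scale_inv_le_one (k ν : ℕ) : (scale k ν)⁻¹ ≤ 1 := inv_le_one_of_one_le₀ (one_le_scale k ν)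

theorem scale_le_scale_succ (k ν : ℕ) : scale k ν ≤ scale k (ν + 1) := by
  unfold scale
  gcongr
  exact ν.le_succ

variable {k : ℕ}

theorem scale_pow (hk : 1 ≤ k) (ν : ℕ) : scale k ν ^ k = (ν : ℝ) + 1 := by
  rw [scale, one_div, Real.rpow_inv_natCast_pow (by positivity) (by omega)]

theorem scale_pow_pred_div (hk : 1 ≤ k) (ν : ℕ) :
    scale k ν ^ (k - 1) / ((ν : ℝ) + 1) = (scale k ν)⁻¹ := by
  rw [← scale_pow hk ν, ← pow_sub_one_mul (by omega : k ≠ 0),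
    div_mul_cancel_left₀ (pow_pos (scale_pos k ν) _).ne']

theorem one_div_le_scale_inv (hk : 1 ≤ k) (ν : ℕ) : 1 / ((ν : ℝ) + 1) ≤ (scale k ν)⁻¹ := by
  rw [← scale_pow_pred_div hk ν]
  gcongr
  exact one_le_pow₀ (one_le_scale k ν)

theorem scale_pow_pred_le (hk : 1 ≤ k) (ν : ℕ) : scale k ν ^ (k - 1) ≤ (ν : ℝ) + 1 := by
  rw [← scale_pow hk ν]
  exact pow_le_pow_right₀ (one_le_scale k ν) (Nat.sub_le k 1)

theorem scale_succ_div_scale_pow (hk : 1 ≤ k) (ν : ℕ) :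
    (scale k (ν + 1) / scale k ν) ^ k = 1 + 1 / ((ν : ℝ) + 1) := by
  rw [div_pow, scale_pow hk, scale_pow hk]
  push_cast
  field_simp

theorem tendsto_scale_inv (hk : 1 ≤ k) : Tendsto (fun ν => (scale k ν)⁻¹) atTop (𝓝 0) := by
  have hk' : (0 : ℝ) < 1 / (k : ℝ) := by positivity
  exact tendsto_inv_atTop_zero.comp ((tendsto_rpow_atTop hk').comp
    (tendsto_atTop_add_const_right _ 1 tendsto_natCast_atTop_atTop))

theorem rpow_add_mul_rpow_sub_one_le {x α : ℝ} (hx : 0 ≤ x) (hα₀ : 0 ≤ α) (hα₁ : α ≤ 1) :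
    x ^ α + α * (x + 1) ^ (α - 1) ≤ (x + 1) ^ α := by
  have hx1 : 0 < x + 1 := by linarith
  have hquot : 1 + -(1 / (x + 1)) = x / (x + 1) := by field_simp; ring
  have hbernoulli := rpow_one_add_le_one_add_mul_self (s := -(1 / (x + 1)))
    (neg_le_neg ((div_le_one hx1).2 (by linarith))) hα₀ hα₁
  rw [hquot, Real.div_rpow hx hx1.le, div_le_iff₀ (by positivity)] at hbernoulli
  rw [Real.rpow_sub_one hx1.ne']
  calc x ^ α + α * ((x + 1) ^ α / (x + 1))
      ≤ (1 + α * -(1 / (x + 1))) * (x + 1) ^ α + α * ((x + 1) ^ α / (x + 1)) := by gcongr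
    _ = (x + 1) ^ α := by ring

theorem log_add_one_div_le_log_add_one {x : ℝ} (hx : 0 < x) :
    Real.log x + 1 / (x + 1) ≤ Real.log (x + 1) := by
  have h := Real.one_sub_inv_le_log_of_pos (x := (x + 1) / x) (by positivity)
  rw [Real.log_div (by positivity) hx.ne', inv_div] at h
  have hquot : 1 - x / (x + 1) = 1 / (x + 1) := by field_simp; ring
  linarith

theorem scale_inv_le_lossExponent_sub (hk : 1 ≤ k) {ν : ℕ} (hν : 1 ≤ ν) :
    (scale k ν)⁻¹ ≤ 2 * (lossExponent k (ν + 1) - lossExponent k ν) := by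
  have hinv : (scale k ν)⁻¹ = ((ν : ℝ) + 1) ^ ((1 - 1 / (k : ℝ)) - 1) := by
    rw [scale, ← Real.rpow_neg (by positivity)]
    ring_nf
  have hlog := log_add_one_div_le_log_add_one (x := ν) (by positivity)
  have hk' : 1 / (k : ℝ) ≤ 1 := by
    rw [div_le_one (by positivity)]
    exact_mod_cast hk
  have hpow := rpow_add_mul_rpow_sub_one_le (x := ν) (α := 1 - 1 / (k : ℝ)) (by positivity)
    (sub_nonneg.2 hk') (sub_le_self _ (by positivity))
  rw [← hinv] at hpow
  have hhalf : (scale k ν)⁻¹ ≤ 2 * ((1 - 1 / (k : ℝ)) * (scale k ν)⁻¹ + 1 / ((ν : ℝ) + 1)) := by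
    rcases hk.eq_or_lt with rfl | hk2
    · have hone : (scale 1 ν)⁻¹ = 1 / ((ν : ℝ) + 1) := by simp [scale]
      rw [hone, Nat.cast_one, div_one, sub_self, zero_mul, zero_add]
      linarith [Nat.one_div_pos_of_nat (α := ℝ) (n := ν)]
    · have hk2' : 1 / (k : ℝ) ≤ 1 / 2 := by
        gcongr
        exact_mod_cast hk2
      have hinv0 := scale_inv_nonneg k ν
      have hdiv : 0 ≤ 1 / ((ν : ℝ) + 1) := by positivity
      nlinarith
  unfold lossExponent
  push_cast
  linarith

theorem one_le_lossExponent (hk : 1 ≤ k) {ν : ℕ} (hν : 1 ≤ ν) : 1 ≤ lossExponent k ν := by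
  have hν' : (1 : ℝ) ≤ ν := by exact_mod_cast hν
  have hk' : 1 / (k : ℝ) ≤ 1 := by
    rw [div_le_one (by positivity)]
    exact_mod_cast hk
  exact le_add_of_nonneg_of_le (Real.log_nonneg hν') (Real.one_le_rpow hν' (sub_nonneg.2 hk'))

theorem le_exp_lossExponent (k : ℕ) {ν : ℕ} (hν : 1 ≤ ν) :
    (ν : ℝ) ≤ Real.exp (lossExponent k ν) := by
  rw [← Real.log_le_iff_le_exp (by positivity), lossExponent]
  exact le_add_of_nonneg_right (by positivity)

theorem sum_Ico_scale_inv_le (hk : 1 ≤ k) {N ν : ℕ} (hN : 1 ≤ N) (hν : N ≤ ν) :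
    ∑ i ∈ Finset.Ico N ν, (scale k i)⁻¹ ≤ 2 * lossExponent k ν := by
  calc ∑ i ∈ Finset.Ico N ν, (scale k i)⁻¹
      ≤ ∑ i ∈ Finset.Ico N ν, 2 * (lossExponent k (i + 1) - lossExponent k i) :=
        Finset.sum_le_sum fun i hi =>
          scale_inv_le_lossExponent_sub hk (hN.trans (Finset.mem_Ico.1 hi).1)
    _ = 2 * (lossExponent k ν - lossExponent k N) := by
        rw [← Finset.mul_sum, Finset.sum_Ico_sub _ hν]
    _ ≤ 2 * lossExponent k ν := by linarith [one_le_lossExponent hk hN]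

end Scale

section CoupledSequences

theorem exp_neg_two_mul_le_one_sub {x : ℝ} (hx0 : 0 ≤ x) (hx : x ≤ 1 / 2) :
    Real.exp (-(2 * x)) ≤ 1 - x := by
  rw [Real.exp_neg, inv_le_iff_one_le_mul₀ (Real.exp_pos _)]
  nlinarith [Real.add_one_le_exp (2 * x)]

theorem mul_pow_mul_exp_neg_sum_le {u x : ℕ → ℝ} {r : ℝ} {N : ℕ} (hr : 0 < r) (hN : 0 ≤ u N)
    (hx0 : ∀ ν ≥ N, 0 ≤ x ν) (hx : ∀ ν ≥ N, 2 * x ν ≤ r)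
    (hu : ∀ ν ≥ N, (r - x ν) * u ν ≤ u (ν + 1)) {ν : ℕ} (hν : N ≤ ν) :
    u N * r ^ (ν - N) * Real.exp (-(2 / r) * ∑ i ∈ Finset.Ico N ν, x i) ≤ u ν := by
  induction ν, hν using Nat.le_induction with
  | base => simp
  | succ ν hν ih =>
    have hstep : r * Real.exp (-(2 / r) * x ν) ≤ r - x ν := by
      have hhalf : x ν / r ≤ 1 / 2 := by
        rw [div_le_div_iff₀ hr two_pos]
        linarith [hx ν hν]
      calc r * Real.exp (-(2 / r) * x ν) = r * Real.exp (-(2 * (x ν / r))) := by ring_nf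
        _ ≤ r * (1 - x ν / r) := by
          gcongr
          exact exp_neg_two_mul_le_one_sub (div_nonneg (hx0 ν hν) hr.le) hhalf
        _ = r - x ν := by field_simp
    have hnonneg : 0 ≤ r - x ν := (by positivity : (0 : ℝ) ≤ _).trans hstep
    rw [Finset.sum_Ico_succ_top hν, mul_add, Real.exp_add, Nat.succ_sub hν, pow_succ]
    calc u N * (r ^ (ν - N) * r) * (Real.exp (-(2 / r) * ∑ i ∈ Finset.Ico N ν, x i) *
          Real.exp (-(2 / r) * x ν))
        = (r * Real.exp (-(2 / r) * x ν)) *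
          (u N * r ^ (ν - N) * Real.exp (-(2 / r) * ∑ i ∈ Finset.Ico N ν, x i)) := by ring
      _ ≤ (r - x ν) * u ν := by gcongr
      _ ≤ u (ν + 1) := hu ν hν

/-- Two nonnegative sequences with growth factors `r` and `r'`, up to interactions of sizes
`ε ν` and `ε' ν`, from the index `m` on. -/
structure IsCoupled (r r' : ℝ) (ε ε' : ℕ → ℝ) (m : ℕ) (p q : ℕ → ℝ) : Prop where
  left_nonneg : ∀ ν, 0 ≤ p ν
  right_nonneg : ∀ ν, 0 ≤ q ν
  le_left_succ : ∀ ν ≥ m, (r - ε ν) * p ν - ε ν * q ν ≤ p (ν + 1)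
  right_succ_le : ∀ ν ≥ m, q (ν + 1) ≤ (r' + ε' ν) * q ν + ε' ν * p ν

namespace IsCoupled

variable {r r' : ℝ} {ε ε' p q : ℕ → ℝ} {m N : ℕ}

theorem mul_left_le_left_succ (h : IsCoupled r r' ε ε' m p q) {ν : ℕ} (hν : m ≤ ν)
    (hε : 0 ≤ ε ν) (hqp : q ν ≤ p ν) : (r - 2 * ε ν) * p ν ≤ p (ν + 1) := by
  linarith [h.le_left_succ ν hν, mul_le_mul_of_nonneg_left hqp hε]

theorem right_lt_left (h : IsCoupled r r' ε ε' m p q) (hm : m ≤ N) (hr' : 0 ≤ r')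
    (hε : ∀ ν, 0 ≤ ε ν) (hε' : ∀ ν, 0 ≤ ε' ν)
    (hgap : ∀ ν ≥ N, r' + 2 * ε' ν < r - 2 * ε ν) (hN : q N < p N) {ν : ℕ} (hν : N ≤ ν) :
    q ν < p ν := by
  induction ν, hν using Nat.le_induction with
  | base => exact hN
  | succ ν hν ih =>
    calc q (ν + 1) ≤ (r' + ε' ν) * q ν + ε' ν * p ν := h.right_succ_le ν (hm.trans hν)
      _ ≤ (r' + ε' ν) * p ν + ε' ν * p ν := by
        have := add_nonneg hr' (hε' ν)
        gcongr
      _ = (r' + 2 * ε' ν) * p ν := by ring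
      _ < (r - 2 * ε ν) * p ν := by
        have := (h.right_nonneg ν).trans_lt ih
        gcongr
        exact hgap ν hν
      _ ≤ p (ν + 1) := h.mul_left_le_left_succ (hm.trans hν) (hε ν) ih.le

theorem mul_pow_mul_exp_neg_le (h : IsCoupled r r' ε ε' m p q) (hm : m ≤ N) (hr : 0 < r)
    (hε : ∀ ν, 0 ≤ ε ν) (hεr : ∀ ν ≥ N, 4 * ε ν ≤ r) (hqp : ∀ ν ≥ N, q ν ≤ p ν) {ν : ℕ}
    (hν : N ≤ ν) :
    p N * r ^ (ν - N) * Real.exp (-(4 / r) * ∑ i ∈ Finset.Ico N ν, ε i) ≤ p ν := by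
  have hsum := mul_pow_mul_exp_neg_sum_le (x := fun ν => 2 * ε ν) hr (h.left_nonneg N)
    (fun ν _ => by linarith [hε ν]) (fun ν hν => by linarith [hεr ν hν])
    (fun ν hν => h.mul_left_le_left_succ (hm.trans hν) (hε ν) (hqp ν hν)) hν
  rw [← Finset.mul_sum] at hsum
  convert hsum using 3
  ring

theorem right_le_pow_mul (h : IsCoupled r r' ε ε' m p q) (hm : m ≤ N) (hε' : ∀ ν, 0 ≤ ε' ν)
    {R : ℝ} (hR : 0 ≤ R) (hR' : ∀ ν ≥ N, r' + 2 * ε' ν ≤ R) (hpq : ∀ ν ≥ N, p ν ≤ q ν) (i : ℕ) :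
    q (N + i) ≤ R ^ i * q N := by
  refine le_geom (u := fun i => q (N + i)) hR i fun j _ => ?_
  have hj : N ≤ N + j := Nat.le_add_right N j
  calc q (N + j + 1) ≤ (r' + ε' (N + j)) * q (N + j) + ε' (N + j) * p (N + j) :=
        h.right_succ_le _ (hm.trans hj)
    _ ≤ (r' + ε' (N + j)) * q (N + j) + ε' (N + j) * q (N + j) := by
        have := hε' (N + j)
        gcongr
        exact hpq _ hj
    _ = (r' + 2 * ε' (N + j)) * q (N + j) := by ring
    _ ≤ R * q (N + j) := mul_le_mul_of_nonneg_right (hR' _ hj) (h.right_nonneg _)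

end IsCoupled

end CoupledSequences

section RootGap

variable {𝕜 : Type*} [NormedField 𝕜]

/-- From the index `m` on, `u` solves the difference equation `diffOp T u = 0` up to an error of
order `1 / ν` relative to `u`. -/
def IsApproxSolution (T : 𝕜[X]) (B : ℝ) (m : ℕ) (u : ℕ → 𝕜) : Prop :=
  ∀ ν ≥ m, ‖diffOp T u ν‖ ≤ B / ((ν : ℝ) + 1) * window T.natDegree u ν

variable {T : 𝕜[X]} {S : Finset 𝕜} {k m : ℕ} {B : ℝ} {u : ℕ → 𝕜}

theorem IsApproxSolution.scale_pow_mul_norm_le (hu : IsApproxSolution T B m u) (hB : 0 ≤ B)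
    (hk : 1 ≤ k) {ν : ℕ} (hν : m ≤ ν) {W : ℝ} (hW : window T.natDegree u ν ≤ W) :
    scale k ν ^ (k - 1) * ‖diffOp T u ν‖ ≤ B * (scale k ν)⁻¹ * W := by
  have hscale := scale_pos k ν
  calc scale k ν ^ (k - 1) * ‖diffOp T u ν‖
      ≤ scale k ν ^ (k - 1) * (B / ((ν : ℝ) + 1) * W) := by
        gcongr
        exact (hu ν hν).trans (by gcongr)
    _ = B * (scale k ν ^ (k - 1) / ((ν : ℝ) + 1)) * W := by ring
    _ = B * (scale k ν)⁻¹ * W := by rw [scale_pow_pred_div hk]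

/-- No root of `T` has absolute value strictly between `r'` and `r`, and the fast roots, those of
absolute value at least `r`, have multiplicity at most `k`. -/
structure HasRootGap (T : 𝕜[X]) (r' r : ℝ) (k : ℕ) : Prop where
  nonneg : 0 ≤ r'
  lt : r' < r
  norm_le_or_le_norm : ∀ z, T.IsRoot z → ‖z‖ ≤ r' ∨ r ≤ ‖z‖
  one_le : 1 ≤ k
  rootMultiplicity_le : ∀ z, r ≤ ‖z‖ → T.rootMultiplicity z ≤ k

theorem rootMultiplicity_le_natDegree (T : 𝕜[X]) (z : 𝕜) : T.rootMultiplicity z ≤ T.natDegree := by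
  classical
  rw [← count_roots]
  exact (Multiset.count_le_card z T.roots).trans T.card_roots'

variable [DecidableEq 𝕜]

/-- The Jordan coordinates belonging to the roots of `T` in `S`, measured at `ν` with weights of
parameter `scale k ν`. -/
noncomputable def scaledNorm (T : 𝕜[X]) (S : Finset 𝕜) (k : ℕ) (u : ℕ → 𝕜) (ν : ℕ) : ℝ :=
  jordanNorm T S (scale k ν) u ν

theorem scaledNorm_nonneg (T : 𝕜[X]) (S : Finset 𝕜) (k : ℕ) (u : ℕ → 𝕜) (ν : ℕ) :
    0 ≤ scaledNorm T S k u ν :=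
  jordanNorm_nonneg T S (scale_pos k ν).le u ν

theorem continuous_scaledNorm (T : 𝕜[X]) (S : Finset 𝕜) (k ν : ℕ) :
    Continuous fun u : ℕ → 𝕜 => scaledNorm T S k u ν :=
  continuous_jordanNorm T S (scale k ν) ν

namespace IsApproxSolution

variable {r C q : ℝ} {ν : ℕ}

theorem le_scaledNorm_succ (hu : IsApproxSolution T B m u) (hB : 0 ≤ B) (hT : T.Monic)
    (hs : T.Splits) (hS : S ⊆ T.roots.toFinset) (hk : 1 ≤ k)
    (hK : ∀ z ∈ S, T.rootMultiplicity z ≤ k) (hr : ∀ z ∈ S, r ≤ ‖z‖) (hq : 0 ≤ q)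
    (hwindow : window T.natDegree u ν ≤ C * (scaledNorm T S k u ν + q)) (hν : m ≤ ν) :
    (r - (1 + S.card * B * C) * (scale k ν)⁻¹) * scaledNorm T S k u ν
        - (1 + S.card * B * C) * (scale k ν)⁻¹ * q
      ≤ scaledNorm T S k u (ν + 1) := by
  have herror := mul_le_mul_of_nonneg_left (hu.scale_pow_mul_norm_le hB hk hν hwindow)
    (Nat.cast_nonneg S.card)
  calc _ ≤ (r - (scale k ν)⁻¹) * scaledNorm T S k u ν
        - S.card * (scale k ν ^ (k - 1) * ‖diffOp T u ν‖) := by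
        linarith [mul_nonneg (scale_inv_nonneg k ν) hq]
    _ ≤ jordanNorm T S (scale k ν) u (ν + 1) :=
        mul_jordanNorm_sub_le_jordanNorm_succ hT hs hS (one_le_scale k ν) hK hr u ν
    _ ≤ scaledNorm T S k u (ν + 1) :=
        jordanNorm_mono T S (scale_pos k ν).le (scale_le_scale_succ k ν) u _

theorem scaledNorm_succ_le (hu : IsApproxSolution T B m u) (hB : 0 ≤ B) (hT : T.Monic)
    (hs : T.Splits) (hS : S ⊆ T.roots.toFinset) (hk : 1 ≤ k)
    (hK : ∀ z ∈ S, T.rootMultiplicity z ≤ k) (hr₀ : 0 ≤ r) (hr : ∀ z ∈ S, ‖z‖ ≤ r) (hC : 0 ≤ C)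
    (hq : 0 ≤ q) (hwindow : window T.natDegree u ν ≤ C * (scaledNorm T S k u ν + q))
    (hν : m ≤ ν) :
    scaledNorm T S k u (ν + 1)
      ≤ (r + (r + 2 + 2 * S.card * B * C) * (scale k ν)⁻¹) * scaledNorm T S k u ν
        + (r + 2 + 2 * S.card * B * C) * (scale k ν)⁻¹ * q := by
  have hp := scaledNorm_nonneg T S k u ν
  have hinv := scale_inv_nonneg k ν
  have herror := mul_le_mul_of_nonneg_left (hu.scale_pow_mul_norm_le hB hk hν hwindow)
    (Nat.cast_nonneg S.card)
  have hgrowth : 1 + 1 / ((ν : ℝ) + 1) ≤ 1 + (scale k ν)⁻¹ :=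
    add_le_add_right (one_div_le_scale_inv hk ν) 1
  calc scaledNorm T S k u (ν + 1)
      ≤ (1 + 1 / ((ν : ℝ) + 1)) * jordanNorm T S (scale k ν) u (ν + 1) := by
        rw [← scale_succ_div_scale_pow hk]
        exact jordanNorm_le_div_pow_mul hK (scale_pos k ν) (scale_le_scale_succ k ν) u _
    _ ≤ (1 + (scale k ν)⁻¹) * ((r + (scale k ν)⁻¹) * scaledNorm T S k u ν
          + S.card * (B * (scale k ν)⁻¹ * (C * (scaledNorm T S k u ν + q)))) := by
        refine mul_le_mul hgrowth ?_ (jordanNorm_nonneg T S (scale_pos k ν).le u _) (by positivity)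
        exact (jordanNorm_succ_le hT hs hS (one_le_scale k ν) hK hr u ν).trans
          (add_le_add_right herror _)
    _ = (1 + (scale k ν)⁻¹) * (r + (scale k ν)⁻¹) * scaledNorm T S k u ν
          + (1 + (scale k ν)⁻¹) *
            (S.card * B * C * (scale k ν)⁻¹ * (scaledNorm T S k u ν + q)) := by
        ring
    _ ≤ (r + (r + 2) * (scale k ν)⁻¹) * scaledNorm T S k u ν
          + 2 * (S.card * B * C * (scale k ν)⁻¹ * (scaledNorm T S k u ν + q)) := by
        gcongr
        · nlinarith [scale_inv_le_one k ν]
        · linarith [scale_inv_le_one k ν]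
    _ ≤ _ := by linarith [mul_nonneg (mul_nonneg hr₀ hinv) hq, mul_nonneg hinv hq]

end IsApproxSolution

/-- The part of `u` that belongs to the roots of `T` of absolute value at least `r`. -/
noncomputable def fastNorm (T : 𝕜[X]) (r : ℝ) (k : ℕ) (u : ℕ → 𝕜) (ν : ℕ) : ℝ :=
  scaledNorm T {z ∈ T.roots.toFinset | r ≤ ‖z‖} k u ν

/-- The part of `u` that belongs to the roots of `T` of absolute value less than `r`. Their
multiplicities are only known to be at most the degree of `T`. -/
noncomputable def slowNorm (T : 𝕜[X]) (r : ℝ) (u : ℕ → 𝕜) (ν : ℕ) : ℝ :=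
  scaledNorm T {z ∈ T.roots.toFinset | ¬r ≤ ‖z‖} T.natDegree u ν

theorem exists_window_le_fastNorm_add_slowNorm (hT : T.Monic) (hs : T.Splits) (r : ℝ) (k : ℕ) :
    ∃ C : ℝ, 0 ≤ C ∧ ∀ u ν,
      window T.natDegree u ν ≤ C * (fastNorm T r k u ν + slowNorm T r u ν) := by
  obtain ⟨C, hC, hbound⟩ := exists_window_le_jordanNorm hT hs
  refine ⟨C, hC, fun u ν => (hbound u ν).trans ?_⟩
  gcongr
  rw [jordanNorm, ← Finset.sum_filter_add_sum_filter_not _ (fun z => r ≤ ‖z‖)]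
  exact add_le_add (jordanNorm_mono T _ zero_le_one (one_le_scale k ν) u ν)
    (jordanNorm_mono T _ zero_le_one (one_le_scale T.natDegree ν) u ν)

namespace HasRootGap

variable {r r' : ℝ}

theorem norm_le_of_mem_slow (h : HasRootGap T r' r k) {z : 𝕜}
    (hz : z ∈ T.roots.toFinset.filter fun z => ¬r ≤ ‖z‖) : ‖z‖ ≤ r' := by
  obtain ⟨hroot, hslow⟩ := Finset.mem_filter.1 hz
  exact (h.norm_le_or_le_norm z (isRoot_of_mem_roots (Multiset.mem_toFinset.1 hroot))).resolve_right
    hslow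

theorem exists_isCoupled (h : HasRootGap T r' r k) (hT : T.Monic) (hs : T.Splits)
    (hdeg : 1 ≤ T.natDegree) (hB : 0 ≤ B) :
    ∃ D D' : ℝ, 0 ≤ D ∧ 0 ≤ D' ∧ ∀ m u, IsApproxSolution T B m u →
      IsCoupled r r' (fun ν => D * (scale k ν)⁻¹) (fun ν => D' * (scale T.natDegree ν)⁻¹) m
        (fastNorm T r k u) (slowNorm T r u) := by
  obtain ⟨C, hC, hwindow⟩ := exists_window_le_fastNorm_add_slowNorm hT hs r k
  have hr' := h.nonneg
  exact ⟨_, _, by positivity, by positivity, fun m u hu =>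
    { left_nonneg := scaledNorm_nonneg T _ k u
      right_nonneg := scaledNorm_nonneg T _ T.natDegree u
      le_left_succ := fun ν hν =>
        hu.le_scaledNorm_succ hB hT hs (Finset.filter_subset _ _) h.one_le
          (fun z hz => h.rootMultiplicity_le z (Finset.mem_filter.1 hz).2)
          (fun z hz => (Finset.mem_filter.1 hz).2) (scaledNorm_nonneg T _ _ u ν) (hwindow u ν) hν
      right_succ_le := fun ν hν =>
        hu.scaledNorm_succ_le hB hT hs (Finset.filter_subset _ _) hdeg
          (fun z _ => rootMultiplicity_le_natDegree T z) hr' (fun z => h.norm_le_of_mem_slow) hC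
          (scaledNorm_nonneg T _ _ u ν) ((hwindow u ν).trans_eq (by rw [add_comm]; rfl)) hν }⟩

theorem exists_slowNorm_lt_fastNorm (h : HasRootGap T r' r k) (hT : T.Monic) (hs : T.Splits)
    (hdeg : 1 ≤ T.natDegree) (hB : 0 ≤ B) :
    ∃ N₀, ∀ m u, IsApproxSolution T B m u → ∀ N, m ≤ N → N₀ ≤ N →
      slowNorm T r u N < fastNorm T r k u N →
        ∀ ν ≥ N, slowNorm T r u ν < fastNorm T r k u ν := by
  obtain ⟨D, D', hD, hD', hcoupled⟩ := h.exists_isCoupled hT hs hdeg hB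
  have hslow := (((tendsto_scale_inv hdeg).const_mul D').const_mul 2).const_add r'
  have hfast := (((tendsto_scale_inv h.one_le).const_mul D).const_mul 2).const_sub r
  obtain ⟨N₀, hgap⟩ := eventually_atTop.1 (hslow.eventually_lt hfast (by simpa using h.lt))
  exact ⟨N₀, fun m u hu N hm hN hlt ν hν => (hcoupled m u hu).right_lt_left hm h.nonneg
    (fun i => mul_nonneg hD (scale_inv_nonneg k i))
    (fun i => mul_nonneg hD' (scale_inv_nonneg _ i)) (fun i hi => hgap i (hN.trans hi)) hlt hν⟩

theorem exists_fastNorm_le_window (h : HasRootGap T r' r k) (hT : T.Monic) (hs : T.Splits) :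
    ∃ C : ℝ, 0 < C ∧ ∀ u : ℕ → 𝕜, ∀ ν ≥ 1,
      fastNorm T r k u ν ≤ C * (Real.exp (lossExponent k ν) * window T.natDegree u ν) := by
  obtain ⟨C, hC, hbound⟩ := exists_jordanNorm_le_window hT hs (Finset.filter_subset _ _)
    fun z hz => h.rootMultiplicity_le z (Finset.mem_filter.1 hz).2
  refine ⟨2 * C + 1, by positivity, fun u ν hν => ?_⟩
  have hwindow := window_nonneg T.natDegree u ν
  calc fastNorm T r k u ν
      ≤ C * (scale k ν ^ (k - 1) * window T.natDegree u ν) := hbound _ (one_le_scale k ν) u ν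
    _ ≤ C * (2 * Real.exp (lossExponent k ν) * window T.natDegree u ν) := by
        gcongr
        linarith [scale_pow_pred_le h.one_le ν, le_exp_lossExponent k hν,
          Real.one_le_exp (zero_le_one.trans (one_le_lossExponent h.one_le hν))]
    _ ≤ (2 * C + 1) * (Real.exp (lossExponent k ν) * window T.natDegree u ν) := by
        linarith [mul_nonneg (Real.exp_pos (lossExponent k ν)).le hwindow]

theorem exists_lower_bound (h : HasRootGap T r' r k) (hT : T.Monic) (hs : T.Splits)
    (hdeg : 1 ≤ T.natDegree) (hB : 0 ≤ B) :
    ∃ N₀, ∃ c > 0, ∃ A, ∀ m u, IsApproxSolution T B m u → ∀ N, m ≤ N → N₀ ≤ N →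
      (∀ ν ≥ N, slowNorm T r u ν ≤ fastNorm T r k u ν) → ∀ ν ≥ N,
        c * fastNorm T r k u N * r ^ (ν - N) * Real.exp (-A * lossExponent k ν)
          ≤ window T.natDegree u ν := by
  obtain ⟨D, D', hD, -, hcoupled⟩ := h.exists_isCoupled hT hs hdeg hB
  obtain ⟨C, hC, hfast⟩ := h.exists_fastNorm_le_window hT hs
  have hr : 0 < r := h.nonneg.trans_lt h.lt
  have hloss := ((tendsto_scale_inv h.one_le).const_mul D).const_mul 4
  obtain ⟨N₀, hsmall⟩ := eventually_atTop.1 (hloss.eventually_le_const (by simpa using hr))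
  refine ⟨max 1 N₀, C⁻¹, by positivity, 1 + 8 * D / r, fun m u hu N hm hN hle ν hν => ?_⟩
  obtain ⟨hN1, hN₀⟩ := max_le_iff.1 hN
  have hgrowth := (hcoupled m u hu).mul_pow_mul_exp_neg_le hm hr
    (fun i => mul_nonneg hD (scale_inv_nonneg k i)) (fun i hi => hsmall i (hN₀.trans hi)) hle hν
  have hexp : Real.exp (-(8 * D / r) * lossExponent k ν)
      ≤ Real.exp (-(4 / r) * ∑ i ∈ Finset.Ico N ν, D * (scale k i)⁻¹) := by
    rw [Real.exp_le_exp, ← Finset.mul_sum]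
    have := mul_le_mul_of_nonneg_left (sum_Ico_scale_inv_le h.one_le hN1 hν)
      (show 0 ≤ 4 / r * D by positivity)
    linarith [show 4 / r * D * (2 * lossExponent k ν) = 8 * D / r * lossExponent k ν by ring]
  have hnonneg : 0 ≤ fastNorm T r k u N := scaledNorm_nonneg T _ k u N
  calc C⁻¹ * fastNorm T r k u N * r ^ (ν - N) * Real.exp (-(1 + 8 * D / r) * lossExponent k ν)
      = C⁻¹ * Real.exp (-lossExponent k ν) *
          (fastNorm T r k u N * r ^ (ν - N) * Real.exp (-(8 * D / r) * lossExponent k ν)) := by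
        rw [neg_add, add_mul, Real.exp_add]
        ring_nf
    _ ≤ C⁻¹ * Real.exp (-lossExponent k ν) *
          (C * (Real.exp (lossExponent k ν) * window T.natDegree u ν)) := by
        refine mul_le_mul_of_nonneg_left ?_ (by positivity)
        exact (mul_le_mul_of_nonneg_left hexp (by positivity)).trans
          (hgrowth.trans (hfast u ν (hN1.trans hν)))
    _ = window T.natDegree u ν := by
        rw [Real.exp_neg]
        field_simp

theorem exists_window_le_mul_pow (h : HasRootGap T r' r k) (hT : T.Monic) (hs : T.Splits)
    (hdeg : 1 ≤ T.natDegree) (hB : 0 ≤ B) (hu : IsApproxSolution T B m u)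
    (hle : ∀ᶠ ν in atTop, fastNorm T r k u ν ≤ slowNorm T r u ν) {R : ℝ} (hR : r' < R) :
    ∃ K : ℝ, ∀ᶠ ν in atTop, window T.natDegree u ν ≤ K * R ^ ν := by
  obtain ⟨D, D', -, hD', hcoupled⟩ := h.exists_isCoupled hT hs hdeg hB
  obtain ⟨C, hC, hwindow⟩ := exists_window_le_fastNorm_add_slowNorm hT hs r k
  have hR0 : 0 < R := h.nonneg.trans_lt hR
  have hlim := (((tendsto_scale_inv hdeg).const_mul D').const_mul 2).const_add r'
  obtain ⟨N, hN⟩ := eventually_atTop.1 ((eventually_ge_atTop m).and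
    (hle.and (hlim.eventually_le_const (by simpa using hR))))
  refine ⟨2 * C * slowNorm T r u N / R ^ N, eventually_atTop.2 ⟨N, fun ν hν => ?_⟩⟩
  have hgrowth := (hcoupled m u hu).right_le_pow_mul (hN N le_rfl).1
    (fun i => mul_nonneg hD' (scale_inv_nonneg _ i)) hR0.le (fun i hi => (hN i hi).2.2)
    (fun i hi => (hN i hi).2.1) (ν - N)
  rw [Nat.add_sub_cancel' hν] at hgrowth
  calc window T.natDegree u ν ≤ C * (fastNorm T r k u ν + slowNorm T r u ν) := hwindow u ν
    _ ≤ C * (2 * (R ^ (ν - N) * slowNorm T r u N)) := by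
        gcongr
        linarith [(hN ν hν).2.1]
    _ = 2 * C * slowNorm T r u N / R ^ N * R ^ ν := by
        rw [pow_sub₀ R hR0.ne' hν]
        ring

theorem eventually_forall_slowNorm_lt_fastNorm (h : HasRootGap T r' r k) (hT : T.Monic)
    (hs : T.Splits) (hdeg : 1 ≤ T.natDegree) (hB : 0 ≤ B) {Y : Set (ℕ → 𝕜)} (hY : IsCompact Y)
    (happrox : ∀ u ∈ Y, IsApproxSolution T B m u)
    (hfreq : ∀ u ∈ Y, ∃ᶠ ν in atTop, slowNorm T r u ν < fastNorm T r k u ν) :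
    ∀ᶠ N in atTop, ∀ u ∈ Y, slowNorm T r u N < fastNorm T r k u N := by
  obtain ⟨N₀, hpersist⟩ := h.exists_slowNorm_lt_fastNorm hT hs hdeg hB
  let U : ℕ → Set (ℕ → 𝕜) := fun i => {u | slowNorm T r u (max m N₀ + i) <
    fastNorm T r k u (max m N₀ + i)}
  have hopen : ∀ i, IsOpen (U i) := fun i =>
    isOpen_lt (continuous_scaledNorm T _ T.natDegree _) (continuous_scaledNorm T _ k _)
  have hcover : Y ⊆ ⋃ i, Set.accumulate U i := fun u hu => by
    obtain ⟨ν, hν, hlt⟩ := frequently_atTop.1 (hfreq u hu) (max m N₀)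
    rw [Set.iUnion_accumulate, Set.mem_iUnion]
    refine ⟨ν - max m N₀, ?_⟩
    rwa [Set.mem_ofPred_eq, Nat.add_sub_cancel' hν]
  obtain ⟨i, hi⟩ := hY.elim_directed_cover _ (fun i => isOpen_biUnion fun j _ => hopen j) hcover
    Set.monotone_accumulate.directed_le
  refine eventually_atTop.2 ⟨max m N₀ + i, fun N hN u hu => ?_⟩
  obtain ⟨j, hj, hlt⟩ := Set.mem_accumulate.1 (hi hu)
  exact hpersist m u (happrox u hu) _ (le_add_right (le_max_left m N₀))
    (le_add_right (le_max_right m N₀)) hlt N (by omega)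

theorem exists_forall_mem_lower_bound (h : HasRootGap T r' r k) (hT : T.Monic)
    (hs : T.Splits) (hdeg : 1 ≤ T.natDegree) (hB : 0 ≤ B) {Y : Set (ℕ → 𝕜)} (hY : IsCompact Y)
    (happrox : ∀ u ∈ Y, IsApproxSolution T B m u)
    (hfreq : ∀ u ∈ Y, ∃ᶠ ν in atTop, slowNorm T r u ν < fastNorm T r k u ν) :
    ∃ c > 0, ∃ A, ∀ᶠ ν in atTop, ∀ u ∈ Y,
      c * r ^ ν * Real.exp (-A * lossExponent k ν) ≤ window T.natDegree u ν := by
  obtain ⟨N₀, c, hc, A, hlower⟩ := h.exists_lower_bound hT hs hdeg hB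
  obtain ⟨N₁, hlt⟩ := eventually_atTop.1
    (h.eventually_forall_slowNorm_lt_fastNorm hT hs hdeg hB hY happrox hfreq)
  obtain ⟨N, hN⟩ : ∃ N, max (max m N₀) N₁ ≤ N := ⟨_, le_rfl⟩
  obtain ⟨⟨hm, hN₀⟩, hN₁⟩ := (max_le_iff.1 hN).imp_left max_le_iff.1
  obtain ⟨δ, hδ, hmin⟩ := hY.exists_forall_le' (continuous_scaledNorm T _ k N).continuousOn
    fun u hu => (scaledNorm_nonneg T _ _ u N).trans_lt (hlt N hN₁ u hu)
  have hr : 0 < r := h.nonneg.trans_lt h.lt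
  refine ⟨c * δ / r ^ N, by positivity, A, eventually_atTop.2 ⟨N, fun ν hν u hu => ?_⟩⟩
  calc c * δ / r ^ N * r ^ ν * Real.exp (-A * lossExponent k ν)
      = c * δ * r ^ (ν - N) * Real.exp (-A * lossExponent k ν) := by
        rw [pow_sub₀ r hr.ne' hν]
        ring
    _ ≤ c * fastNorm T r k u N * r ^ (ν - N) * Real.exp (-A * lossExponent k ν) := by
        gcongr
        exact hmin u hu
    _ ≤ window T.natDegree u ν :=
        hlower m u (happrox u hu) N hm hN₀ (fun i hi => (hlt i (hN₁.trans hi) u hu).le) ν hν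

end HasRootGap

end RootGap

section LossExponent

theorem tendsto_exp_neg_mul_mul {x : ℝ} (hx : 0 < x) (y : ℝ) :
    Tendsto (fun A : ℝ => Real.exp (-A * x) * y) atTop (𝓝 0) := by
  have hlim : Tendsto (fun A : ℝ => -A * x) atTop atBot :=
    tendsto_neg_atTop_atBot.atBot_mul_const hx
  simpa using (Real.tendsto_exp_atBot.comp hlim).mul_const y

/-- The constant `c` and the finitely many exceptional indices are absorbed by `A'`, because
`lossExponent k ν ≥ 1`. -/
theorem exists_exp_neg_mul_lossExponent_mul_pow_le {ι : Type*} {Y : Set ι} {w : ι → ℕ → ℝ}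
    {k m : ℕ} {r c A : ℝ} (hk : 1 ≤ k) (hm : 1 ≤ m) (hr : 0 ≤ r) (hc : 0 < c)
    (hpos : ∀ ν ≥ m, ∃ δ > 0, ∀ y ∈ Y, δ ≤ w y ν)
    (hlower : ∀ᶠ ν in atTop, ∀ y ∈ Y, c * r ^ ν * Real.exp (-A * lossExponent k ν) ≤ w y ν) :
    ∃ A' > 0, ∀ y ∈ Y, ∀ ν ≥ m, Real.exp (-A' * lossExponent k ν) * r ^ ν ≤ w y ν := by
  obtain ⟨N, hN⟩ := eventually_atTop.1 hlower
  have hfinite : ∀ᶠ A' : ℝ in atTop, ∀ ν ∈ Finset.Ico m N, ∀ y ∈ Y,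
      Real.exp (-A' * lossExponent k ν) * r ^ ν ≤ w y ν := by
    refine (Finset.eventually_all _).2 fun ν hν => ?_
    have hmν := (Finset.mem_Ico.1 hν).1
    obtain ⟨δ, hδ, hle⟩ := hpos ν hmν
    have hloss : 0 < lossExponent k ν :=
      zero_lt_one.trans_le (one_le_lossExponent hk (hm.trans hmν))
    filter_upwards [(tendsto_exp_neg_mul_mul hloss (r ^ ν)).eventually_le_const hδ] with A' hA' y hy
    exact hA'.trans (hle y hy)
  obtain ⟨A', hsmall, hA', hA'0⟩ := (hfinite.and ((eventually_ge_atTop (A - Real.log c)).and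
    ((eventually_ge_atTop A).and (eventually_gt_atTop 0)))).exists
  refine ⟨A', hA'0.2, fun y hy ν hν => ?_⟩
  rcases lt_or_ge ν N with hνN | hνN
  · exact hsmall ν (Finset.mem_Ico.2 ⟨hν, hνN⟩) y hy
  have hloss := one_le_lossExponent hk (hm.trans hν)
  have hexp : Real.exp (-A' * lossExponent k ν) ≤ c * Real.exp (-A * lossExponent k ν) := by
    conv_rhs => rw [← Real.exp_log hc]
    rw [← Real.exp_add, Real.exp_le_exp]
    nlinarith [hA'0.1]
  calc Real.exp (-A' * lossExponent k ν) * r ^ ν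
      ≤ c * Real.exp (-A * lossExponent k ν) * r ^ ν := by gcongr
    _ = c * r ^ ν * Real.exp (-A * lossExponent k ν) := by ring
    _ ≤ w y ν := hN ν hνN y hy

end LossExponent

section GrowthRate

variable {m : ℕ} {y : Set.Ici m → ℂ} {R : ℝ}

theorem growthRate_le_of_eventually_le_mul_pow {K : ℝ} (hR : 0 ≤ R)
    (h : ∀ᶠ ν : Set.Ici m in atTop, ‖y ν‖ ≤ K * R ^ ν.1) : growthRate y ≤ ENNReal.ofReal R := by
  have hK : 0 < max K 1 := lt_max_of_lt_right one_pos
  have hexponent : Tendsto (fun ν : Set.Ici m => 1 / (ν.1 : ℝ)) atTop (𝓝 0) :=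
    tendsto_one_div_atTop_nhds_zero_nat.comp (tendsto_coe_Ici m)
  have hlim : Tendsto (fun ν : Set.Ici m => ENNReal.ofReal (max K 1 ^ (1 / (ν.1 : ℝ)) * R)) atTop
      (𝓝 (ENNReal.ofReal R)) := by
    simpa using ENNReal.tendsto_ofReal
      ((tendsto_const_nhds.rpow hexponent (Or.inl hK.ne')).mul_const R)
  rw [← hlim.limsup_eq, growthRate]
  refine limsup_le_limsup ?_
  filter_upwards [h, (tendsto_coe_Ici m).eventually (eventually_ge_atTop 1)] with ν hle hν
  have hexp : (0 : ℝ) ≤ 1 / (ν.1 : ℝ) := by positivity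
  rw [← ofReal_norm, ENNReal.ofReal_rpow_of_nonneg (norm_nonneg _) hexp]
  refine ENNReal.ofReal_le_ofReal ?_
  calc ‖y ν‖ ^ (1 / (ν.1 : ℝ)) ≤ (max K 1 * R ^ ν.1) ^ (1 / (ν.1 : ℝ)) := by
        gcongr
        exact hle.trans (by gcongr; exact le_max_left K 1)
    _ = max K 1 ^ (1 / (ν.1 : ℝ)) * R := by
        rw [Real.mul_rpow hK.le (by positivity), one_div (ν.1 : ℝ),
          Real.pow_rpow_inv_natCast hR (by omega)]

theorem growthRate_le_of_forall_gt {r : ℝ} (hr : 0 ≤ r)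
    (h : ∀ R > r, growthRate y ≤ ENNReal.ofReal R) : growthRate y ≤ ENNReal.ofReal r := by
  refine le_of_forall_gt_imp_ge_of_dense fun b hb => ?_
  obtain ⟨R, -, hrR, hRb⟩ := ENNReal.lt_iff_exists_real_btwn.1 hb
  exact (h R ((ENNReal.ofReal_lt_ofReal_iff_of_nonneg hr).1 hrR)).trans hRb.le

end GrowthRate

section Solutions

/-- The extension by zero of a sequence `y(m), y(m + 1), …` to all indices. -/
noncomputable def zeroExtend {m : ℕ} (y : Set.Ici m → ℂ) : ℕ → ℂ :=
  Function.extend Subtype.val y 0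

/-- The smallest index of the sequences in `solutionSpace a m`. -/
abbrev initialIndex (m : ℕ) : Set.Ici m :=
  ⟨m, Set.mem_Ici.2 le_rfl⟩

variable {n m : ℕ} {y : Set.Ici m → ℂ}

theorem zeroExtend_coe (y : Set.Ici m → ℂ) (ν : Set.Ici m) : zeroExtend y ν = y ν :=
  Subtype.val_injective.extend_apply y (0 : ℕ → ℂ) ν

theorem zeroExtend_coe_add (y : Set.Ici m → ℂ) (ν : Set.Ici m) (i : ℕ) :
    zeroExtend y (ν + i) = y (shift ν i) :=
  zeroExtend_coe y (shift ν i)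

theorem window_zeroExtend (n : ℕ) (y : Set.Ici m → ℂ) (ν : Set.Ici m) :
    window n (zeroExtend y) ν = omega n y ν := by
  simp only [window, omega, zeroExtend_coe_add]

theorem continuous_zeroExtend (m : ℕ) :
    Continuous (zeroExtend : (Set.Ici m → ℂ) → ℕ → ℂ) := by
  refine continuous_pi fun ν => ?_
  by_cases hν : m ≤ ν
  · exact (continuous_apply _).congr fun y => (zeroExtend_coe y ⟨ν, hν⟩).symm
  · refine continuous_const.congr fun y => (Function.extend_apply' y (0 : ℕ → ℂ) ν ?_).symm
    rintro ⟨μ, rfl⟩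
    exact hν μ.2

theorem continuous_omega (n : ℕ) (ν : Set.Ici m) :
    Continuous fun y : Set.Ici m → ℂ => omega n y ν :=
  (continuous_pi fun _ => continuous_apply _).norm

theorem omega_nonneg (n : ℕ) (y : Set.Ici m → ℂ) (ν : Set.Ici m) : 0 ≤ omega n y ν := norm_nonneg _

theorem omega_smul (n : ℕ) (c : ℂ) (y : Set.Ici m → ℂ) (ν : Set.Ici m) :
    omega n (c • y) ν = ‖c‖ * omega n y ν := by
  rw [omega, omega, ← norm_smul]
  rfl

variable {a : Fin (n + 1) → ℕ → ℂ}

theorem sum_mul_zeroExtend_eq_zero (hy : y ∈ solutionSpace a m) {ν : ℕ} (hν : m ≤ ν) :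
    ∑ i : Fin (n + 1), a i ν * zeroExtend y (ν + i) = 0 := by
  simpa only [← zeroExtend_coe_add] using hy ⟨ν, hν⟩

theorem apply_eq_zero_of_omega_eq_zero (ha_last : ∀ ν, a (Fin.last n) ν = 1)
    (hy : y ∈ solutionSpace a m) {μ ν : Set.Ici m} (h : omega n y μ = 0) (hν : μ ≤ ν) :
    y ν = 0 := by
  suffices hall : ∀ i, zeroExtend y (μ + i) = 0 by
    have := hall (ν - μ)
    rwa [Nat.add_sub_cancel' hν, zeroExtend_coe] at this
  intro i
  induction i using Nat.strong_induction_on with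
  | _ i ih =>
    rcases lt_or_ge i n with hi | hi
    · rw [← norm_le_zero_iff, ← h, ← window_zeroExtend]
      exact norm_le_window hi _ _
    · have hrec := sum_mul_zeroExtend_eq_zero hy (le_add_right μ.2 : m ≤ μ + (i - n))
      rwa [Fin.sum_univ_castSucc, Finset.sum_eq_zero, zero_add, ha_last, one_mul, Fin.val_last,
        add_assoc, Nat.sub_add_cancel hi] at hrec
      intro j _
      rw [add_assoc, ih _ (by rw [Fin.val_castSucc]; omega), mul_zero]

theorem omega_pos_of_le (ha_last : ∀ ν, a (Fin.last n) ν = 1) (hy : y ∈ solutionSpace a m)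
    {μ ν : Set.Ici m} (hν : μ ≤ ν) (h : 0 < omega n y ν) : 0 < omega n y μ :=
  (omega_nonneg n y μ).lt_of_ne' fun hμ => h.ne' (norm_eq_zero.2 (funext fun _ =>
    apply_eq_zero_of_omega_eq_zero ha_last hy hμ (hν.trans (Nat.le_add_right _ _))))

theorem eq_zero_of_omega_initialIndex_eq_zero (ha_last : ∀ ν, a (Fin.last n) ν = 1)
    (hy : y ∈ solutionSpace a m) (h : omega n y (initialIndex m) = 0) : y = 0 :=
  funext fun ν => apply_eq_zero_of_omega_eq_zero ha_last hy h ν.2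

theorem isCompact_setOf_omega_initialIndex_eq_one (ha_last : ∀ ν, a (Fin.last n) ν = 1)
    {V : Submodule ℂ (Set.Ici m → ℂ)} (hV : V ≤ solutionSpace a m) :
    IsCompact {y | y ∈ V ∧ omega n y (initialIndex m) = 1} := by
  let initialValues : V →ₗ[ℂ] (Fin n → ℂ) :=
    (LinearMap.funLeft ℂ ℂ fun j : Fin n => shift (initialIndex m) j) ∘ₗ V.subtype
  have hker : LinearMap.ker initialValues = ⊥ := LinearMap.ker_eq_bot'.2 fun y hy =>
    Subtype.ext (eq_zero_of_omega_initialIndex_eq_zero ha_last (hV y.2) (norm_eq_zero.2 hy))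
  have : FiniteDimensional ℂ V :=
    Module.Finite.of_injective initialValues (LinearMap.ker_eq_bot.1 hker)
  have hcompact := (LinearMap.isClosedEmbedding_of_injective hker).isCompact_preimage
    (isCompact_sphere (0 : Fin n → ℂ) 1)
  convert hcompact.image continuous_subtype_val using 1
  ext y
  simp only [Set.mem_image, Set.mem_preimage, mem_sphere_zero_iff_norm, Subtype.exists]
  exact ⟨fun ⟨hy, h⟩ => ⟨y, hy, h, rfl⟩, fun ⟨_, hx, h, hxy⟩ => hxy ▸ ⟨hx, h⟩⟩

end Solutions

section CharPoly

variable {n m k : ℕ} {a : Fin (n + 1) → ℕ → ℂ} {a' : Fin (n + 1) → ℂ} {y : Set.Ici m → ℂ} {c : ℝ}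

theorem monic_charPoly (h : a' (Fin.last n) = 1) : (charPoly a').Monic := by
  rw [charPoly, Fin.sum_univ_castSucc, h, add_comm]
  simpa using monic_X_pow_add (degree_sum_fin_lt fun i : Fin n => a' i.castSucc)

theorem natDegree_charPoly (h : a' (Fin.last n) = 1) : (charPoly a').natDegree = n := by
  have hdeg := degree_sum_fin_lt fun i : Fin n => a' i.castSucc
  rw [charPoly, Fin.sum_univ_castSucc, h, add_comm]
  simpa using natDegree_add_eq_left_of_degree_lt (hdeg.trans_eq (degree_X_pow n).symm)

theorem diffOp_charPoly_apply (a' : Fin (n + 1) → ℂ) (u : ℕ → ℂ) (ν : ℕ) :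
    diffOp (charPoly a') u ν = ∑ i : Fin (n + 1), a' i * u (ν + i) := by
  simp only [charPoly, C_mul', map_sum, map_smul, LinearMap.sum_apply, LinearMap.smul_apply,
    Finset.sum_apply, Pi.smul_apply, smul_eq_mul, diffOp_X_pow_apply]

theorem isApproxSolution_zeroExtend (ha_last : ∀ ν, a (Fin.last n) ν = 1)
    (ha'_last : a' (Fin.last n) = 1) (ha : ∀ i ν, ‖a i ν - a' i‖ ≤ c / ((ν : ℝ) + 1))
    (hy : y ∈ solutionSpace a m) :
    IsApproxSolution (charPoly a') (n * c) m (zeroExtend y) := by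
  intro ν hν
  have hdiff : diffOp (charPoly a') (zeroExtend y) ν
      = ∑ i : Fin n, (a' i.castSucc - a i.castSucc ν) * zeroExtend y (ν + i) := by
    rw [diffOp_charPoly_apply, ← sub_zero (∑ i, _), ← sum_mul_zeroExtend_eq_zero hy hν,
      ← Finset.sum_sub_distrib, Fin.sum_univ_castSucc, ha_last, ha'_last, sub_self, add_zero]
    simp only [sub_mul, Fin.val_castSucc]
  rw [hdiff, natDegree_charPoly ha'_last]
  calc ‖∑ i : Fin n, (a' i.castSucc - a i.castSucc ν) * zeroExtend y (ν + i)‖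
      ≤ ∑ _i : Fin n, c / ((ν : ℝ) + 1) * window n (zeroExtend y) ν := by
        refine norm_sum_le_of_le _ fun i _ => ?_
        rw [norm_mul, norm_sub_rev]
        exact mul_le_mul (ha _ ν) (norm_le_window i.2 _ ν) (norm_nonneg _)
          ((norm_nonneg _).trans (ha i.castSucc ν))
    _ = n * c / ((ν : ℝ) + 1) * window n (zeroExtend y) ν := by
        rw [Finset.sum_const, Finset.card_univ, Fintype.card_fin, nsmul_eq_mul]
        ring

theorem exists_norm_sub_le_div {ι : Type*} [Finite ι] {f : ι → ℕ → ℂ} {g : ι → ℂ}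
    (h : ∀ i, (fun ν => f i ν - g i) =O[atTop] fun ν : ℕ => 1 / ((ν : ℝ) + 1)) :
    ∃ c : ℝ, 0 ≤ c ∧ ∀ i ν, ‖f i ν - g i‖ ≤ c / ((ν : ℝ) + 1) := by
  have := Fintype.ofFinite ι
  obtain ⟨c, hc, hbound⟩ := Asymptotics.bound_of_isBigO_nat_atTop (Asymptotics.isBigO_pi.2 h)
  refine ⟨c, hc.le, fun i ν => ?_⟩
  have hpos : 0 < 1 / ((ν : ℝ) + 1) := by positivity
  calc ‖f i ν - g i‖ ≤ ‖fun i => f i ν - g i‖ := norm_le_pi_norm (fun i => f i ν - g i) i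
    _ ≤ c * ‖1 / ((ν : ℝ) + 1)‖ := hbound hpos.ne'
    _ = c / ((ν : ℝ) + 1) := by rw [Real.norm_of_nonneg hpos.le, mul_one_div]

theorem eq_of_isBigO_one_div {x z : ℂ}
    (h : (fun _ : ℕ => x - z) =O[atTop] fun ν : ℕ => 1 / ((ν : ℝ) + 1)) : x = z :=
  sub_eq_zero.1 (tendsto_const_nhds_iff.1
    (h.trans_tendsto tendsto_one_div_add_atTop_nhds_zero_nat))

theorem growthRate_le_of_eventually_window_le {r : ℝ} (hn : 1 ≤ n) (hr : 0 ≤ r)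
    (h : ∀ R > r, ∃ K : ℝ, ∀ᶠ ν in atTop, window n (zeroExtend y) ν ≤ K * R ^ ν) :
    growthRate y ≤ ENNReal.ofReal r := by
  refine growthRate_le_of_forall_gt hr fun R hR => ?_
  obtain ⟨K, hK⟩ := h R hR
  refine growthRate_le_of_eventually_le_mul_pow (hr.trans hR.le) (K := K) ?_
  filter_upwards [(tendsto_coe_Ici m).eventually hK] with ν hν
  rw [← zeroExtend_coe y]
  exact (norm_le_window (i := 0) hn _ _).trans hν

namespace HasRootGap

variable {r r' : ℝ}

theorem frequently_slowNorm_lt_fastNorm (h : HasRootGap (charPoly a') r' r k) (hn : 1 ≤ n)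
    (ha_last : ∀ ν, a (Fin.last n) ν = 1) (ha'_last : a' (Fin.last n) = 1) (hc : 0 ≤ c)
    (ha : ∀ i ν, ‖a i ν - a' i‖ ≤ c / ((ν : ℝ) + 1)) (hy : y ∈ solutionSpace a m)
    (hslow : y ∉ slowSubspace a m r') :
    ∃ᶠ ν in atTop,
      slowNorm (charPoly a') r (zeroExtend y) ν < fastNorm (charPoly a') r k (zeroExtend y) ν := by
  by_contra hnot
  refine hslow ⟨hy, growthRate_le_of_eventually_window_le hn h.nonneg fun R hR => ?_⟩
  have hdeg := natDegree_charPoly ha'_last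
  simpa only [hdeg] using h.exists_window_le_mul_pow (monic_charPoly ha'_last)
    (IsAlgClosed.splits _) (hn.trans_eq hdeg.symm) (by positivity)
    (isApproxSolution_zeroExtend ha_last ha'_last ha hy)
    ((not_frequently.1 hnot).mono fun _ => le_of_not_gt) hR

theorem exists_forall_mem_exp_mul_pow_le_omega (h : HasRootGap (charPoly a') r' r k) (hn : 1 ≤ n)
    (ha_last : ∀ ν, a (Fin.last n) ν = 1)
    (ha : ∀ i, (fun ν => a i ν - a' i) =O[atTop] fun ν : ℕ => 1 / ((ν : ℝ) + 1)) (hm : 1 ≤ m)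
    {Y : Set (Set.Ici m → ℂ)} (hY : IsCompact Y) (hsol : ∀ y ∈ Y, y ∈ solutionSpace a m)
    (hslow : ∀ y ∈ Y, y ∉ slowSubspace a m r') :
    ∃ A > 0, ∀ y ∈ Y, ∀ ν : Set.Ici m,
      Real.exp (-A * lossExponent k ν) * r ^ (ν : ℕ) ≤ omega n y ν := by
  obtain ⟨b, hb, hab⟩ := exists_norm_sub_le_div ha
  have ha'_last : a' (Fin.last n) = 1 :=
    (eq_of_isBigO_one_div (by simpa only [ha_last] using ha (Fin.last n))).symm
  have hdeg := natDegree_charPoly ha'_last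
  obtain ⟨c, hc, A, hlower⟩ := h.exists_forall_mem_lower_bound (monic_charPoly ha'_last)
    (IsAlgClosed.splits _) (hn.trans_eq hdeg.symm) (show 0 ≤ n * b by positivity)
    (hY.image (continuous_zeroExtend m))
    (Set.forall_mem_image.2 fun y hy =>
      isApproxSolution_zeroExtend ha_last ha'_last hab (hsol y hy))
    (Set.forall_mem_image.2 fun y hy => h.frequently_slowNorm_lt_fastNorm hn ha_last ha'_last hb hab
      (hsol y hy) (hslow y hy))
  simp only [Set.forall_mem_image, hdeg] at hlower
  have hr : 0 < r := h.nonneg.trans_lt h.lt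
  have hpos : ∀ ν ≥ m, ∃ δ > 0, ∀ y ∈ Y, δ ≤ window n (zeroExtend y) ν := fun ν hν => by
    obtain ⟨N, hN, hle⟩ := ((eventually_ge_atTop ν).and hlower).exists
    have hmin := hY.exists_forall_le' (continuous_omega n ⟨ν, hν⟩).continuousOn fun y hy =>
      omega_pos_of_le ha_last (hsol y hy) (ν := ⟨N, hν.trans hN⟩) hN <|
        (show 0 < c * r ^ N * Real.exp (-A * lossExponent k N) by positivity).trans_le
          ((hle hy).trans_eq (window_zeroExtend n y ⟨N, hν.trans hN⟩))
    simpa only [← window_zeroExtend] using hmin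
  obtain ⟨A', hA', hle⟩ :=
    exists_exp_neg_mul_lossExponent_mul_pow_le h.one_le hm hr.le hc hpos hlower
  exact ⟨A', hA', fun y hy ν => (hle y hy ν ν.2).trans_eq (window_zeroExtend n y ν)⟩

end HasRootGap

end CharPoly

theorem rootMultiplicity_le_multMax {T : ℂ[X]} {z : ℂ} (hz : z ∈ T.roots.toFinset) :
    T.rootMultiplicity z ≤ multMax T ‖z‖ :=
  Finset.le_sup (f := fun z => T.rootMultiplicity z) (Finset.mem_filter.2 ⟨hz, rfl⟩)

theorem multMax_pos_of_multSum_pos {T : ℂ[X]} {r : ℝ} (h : 0 < multSum T r) :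
    0 < multMax T r := by
  obtain ⟨z, hz, hpos⟩ := Finset.exists_ne_zero_of_sum_ne_zero h.ne'
  exact (Nat.pos_of_ne_zero hpos).trans_le (Finset.le_sup (f := fun z => T.rootMultiplicity z) hz)

theorem hasRootGap_of_strictAnti {s : ℕ} {T : ℂ[X]} {ρ : Fin (s + 1) → ℝ} (hρ : StrictAnti ρ)
    (hρ_last : ρ (Fin.last s) = 0) (hroots : ∀ z, T.IsRoot z → ∃ i, ‖z‖ = ρ i) {θ : Fin s}
    (hθ : 0 < multSum T (ρ θ.castSucc)) :
    HasRootGap T (ρ θ.succ) (ρ θ.castSucc)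
      (Finset.univ.sup fun i : Fin s => multMax T (ρ i.castSucc)) where
  nonneg := hρ_last.symm.trans_le (hρ.antitone (Fin.le_last _))
  lt := hρ Fin.castSucc_lt_succ
  norm_le_or_le_norm z hz := by
    obtain ⟨i, hi⟩ := hroots z hz
    rw [hi, hρ.le_iff_ge, hρ.le_iff_ge, ← Fin.castSucc_lt_iff_succ_le]
    exact lt_or_ge _ _
  one_le := (multMax_pos_of_multSum_pos hθ).trans_le
    (Finset.le_sup (f := fun i : Fin s => multMax T (ρ i.castSucc)) (Finset.mem_univ θ))
  rootMultiplicity_le z hz := by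
    by_cases hroot : z ∈ T.roots.toFinset
    · obtain ⟨i, hi⟩ := hroots z (isRoot_of_mem_roots (Multiset.mem_toFinset.1 hroot))
      rw [hi, hρ.le_iff_ge] at hz
      obtain ⟨j, rfl⟩ := Fin.exists_castSucc_eq.2 (hz.trans_lt (Fin.castSucc_lt_last θ)).ne
      refine (hi ▸ rootMultiplicity_le_multMax hroot).trans ?_
      exact Finset.le_sup (f := fun i : Fin s => multMax T (ρ i.castSucc)) (Finset.mem_univ j)
    · rw [← count_roots, Multiset.count_eq_zero_of_notMem (by simpa using hroot)]
      exact Nat.zero_le _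

theorem mul_omega_initialIndex_le {n m : ℕ} {V : Submodule ℂ (Set.Ici m → ℂ)} {x : ℝ}
    {ν : Set.Ici m} (h : ∀ y ∈ V, omega n y (initialIndex m) = 1 → x ≤ omega n y ν)
    {y : Set.Ici m → ℂ} (hy : y ∈ V) : x * omega n y (initialIndex m) ≤ omega n y ν := by
  rcases (omega_nonneg n y (initialIndex m)).eq_or_lt with hzero | hpos
  · rw [← hzero, mul_zero]
    exact omega_nonneg n y ν
  · have hnorm : ‖((omega n y (initialIndex m))⁻¹ : ℂ)‖ = (omega n y (initialIndex m))⁻¹ := by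
      rw [norm_inv, Complex.norm_of_nonneg hpos.le]
    have hle := h _ (V.smul_mem (omega n y (initialIndex m) : ℂ)⁻¹ hy)
      (by rw [omega_smul, hnorm, inv_mul_cancel₀ hpos.ne'])
    rwa [omega_smul, hnorm, inv_mul_eq_div, le_div_iff₀ hpos] at hle

end PoincareDifference

open PoincareDifference in
theorem theorem10_general {n m k : ℕ} (hn : 1 ≤ n) {a : Fin (n + 1) → ℕ → ℂ}
    {a' : Fin (n + 1) → ℂ} (ha_last : ∀ ν, a (Fin.last n) ν = 1)
    (ha : ∀ i, (fun ν => a i ν - a' i) =O[atTop] fun ν : ℕ => 1 / ((ν : ℝ) + 1)) {r r' : ℝ}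
    (h : HasRootGap (charPoly a') r' r k) (hm : 1 ≤ m) {V : Submodule ℂ (Set.Ici m → ℂ)}
    (hV : V ≤ solutionSpace a m) (hVslow : V ⊓ slowSubspace a m r' = ⊥) :
    ∃ A : ℝ, 0 < A ∧ ∀ y ∈ V, ∀ ν : Set.Ici m,
      Real.exp (-A * (Real.log ((ν : ℕ) : ℝ) + ((ν : ℕ) : ℝ) ^ (1 - 1 / (k : ℝ))))
          * r ^ (ν : ℕ) * omega n y ⟨m, Set.mem_Ici.2 le_rfl⟩
        ≤ omega n y ν := by
  have hslow : ∀ y ∈ {y | y ∈ V ∧ omega n y (initialIndex m) = 1}, y ∉ slowSubspace a m r' := by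
    rintro y ⟨hy, hone⟩ hmem
    obtain rfl : y = 0 := (Submodule.mem_bot ℂ).1 (hVslow ▸ Submodule.mem_inf.2 ⟨hy, hmem⟩)
    exact zero_ne_one (norm_zero.symm.trans hone)
  obtain ⟨A, hA, hle⟩ := h.exists_forall_mem_exp_mul_pow_le_omega hn ha_last ha hm
    (isCompact_setOf_omega_initialIndex_eq_one ha_last hV) (fun y hy => hV hy.1) hslow
  exact ⟨A, hA, fun y hy ν =>
    mul_omega_initialIndex_le (fun x hx hone => hle x ⟨hx, hone⟩ ν) hy⟩

/-- The moduli `ρ_1 > … > ρ_{s+1} = 0` are indexed by `Fin (s + 1)`, and `θ ∈ {1, …, s}` by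
`Fin s`: then `ρ_θ` is `ρ θ.castSucc` and `ρ_{θ+1}` is `ρ θ.succ`. -/
theorem theorem10 (s n : ℕ) (hn : 1 ≤ n)
    (a : Fin (n + 1) → ℕ → ℂ) (a' : Fin (n + 1) → ℂ)
    (ha_last : ∀ ν : ℕ, a (Fin.last n) ν = 1)
    (ha : ∀ i : Fin (n + 1),
      (fun ν : ℕ => a i ν - a' i) =O[Filter.atTop] fun ν : ℕ => 1 / ((ν : ℝ) + 1))
    (ρ : Fin (s + 1) → ℝ) (hρ : StrictAnti ρ) (hρ_last : ρ (Fin.last s) = 0)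
    (hroots : ∀ z : ℂ, (PoincareDifference.charPoly a').IsRoot z → ∃ i, ‖z‖ = ρ i)
    (he : ∀ i : Fin s,
      0 < PoincareDifference.multSum (PoincareDifference.charPoly a') (ρ i.castSucc))
    (k : ℕ)
    (hk : k = Finset.univ.sup fun i : Fin s =>
      PoincareDifference.multMax (PoincareDifference.charPoly a') (ρ i.castSucc))
    (m : ℕ) (hm : 1 ≤ m) (θ : Fin s)
    (V : Submodule ℂ (Set.Ici m → ℂ)) (hV : V ≤ PoincareDifference.solutionSpace a m)
    (hVθ : V ⊓ PoincareDifference.slowSubspace a m (ρ θ.succ) = ⊥) :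
    ∃ A : ℝ, 0 < A ∧ ∀ y ∈ V, ∀ ν : Set.Ici m,
      Real.exp (-A * (Real.log ((ν : ℕ) : ℝ) + ((ν : ℕ) : ℝ) ^ (1 - 1 / (k : ℝ))))
          * ρ θ.castSucc ^ (ν : ℕ) * PoincareDifference.omega n y ⟨m, Set.mem_Ici.2 le_rfl⟩
        ≤ PoincareDifference.omega n y ν := by
  subst hk
  exact theorem10_general hn ha_last ha
    (PoincareDifference.hasRootGap_of_strictAnti hρ hρ_last hroots (he θ)) hm hV hVθ
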